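/- Let $m,c,b,r\in\mathbb N$ and let $k_1,\dots,k_m\le r$ be the lengths of $m$ integrator chains. The state $\boldsymbol s$ has the coordinates $y_i^{(j)}$ ($1\le i\le m$, $0\le j<k_i$), the control $\boldsymbol a$ has the coordinates $y_i^{(k_i)}$, and $\dot{\boldsymbol s}=\boldsymbol I(\boldsymbol s,\boldsymbol a)$ denotes the integrator dynamics $\frac{d}{dt}y_i^{(j)}=y_i^{(j+1)}$ ($j<k_i$). Let $\mathcal Y$ be an open set of pairs $(\boldsymbol s,\boldsymbol a)$, let $t^0<t^f$, let $\Psi:\mathcal Y\to\mathbb R$ and $\boldsymbol g:\mathcal Y\times\mathbb R\to\mathbb R^c$ be of class $C^{r+1}$ and let $\Phi:\mathcal Y\to\mathbb R$ be of class $C^1$. Consider the problem $$\min_{\boldsymbol a}\ \Phi(\boldsymbol s(t^f),\boldsymbol a(t^f))+\int_{t^0}^{t^f}\Psi(\boldsymbol s(t),\boldsymbol a(t))\,dt$$ subject to $(\boldsymbol s,\boldsymbol a)\in\mathcal Y$, $\dot{\boldsymbol s}=\boldsymbol I(\boldsymbol s,\boldsymbol a)$, $\boldsymbol g(\boldsymbol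 s(t),\boldsymbol a(t),t)\le 0$ on $[t^0,t^f]$ and to initial and final conditions $\boldsymbol\beta(\boldsymbol s(t^0),\boldsymbol s(t^f))=0\in\mathbb R^b$, over piecewise continuous controls $\boldsymbol a$ (finitely many continuous pieces on closed intervals; at a junction the control has two one-sided limits, and domain and constraints are imposed on both). Let $(\boldsymbol s,\boldsymbol a)$ be an optimal trajectory, with arcs $[\tau_l,\tau_{l+1}]$, $t^0=\tau_0<\dots<\tau_N=t^f$, such that: $\boldsymbol\beta$ is $C^1$ near $(\boldsymbol s(t^0),\boldsymbol s(t^f))$; $\boldsymbol a$ is of class $C^r$ on each open arc $(\tau_l,\tau_{l+1})$; on each open arc every component of $\boldsymbol g$ is either identically zero or everywhere negative along the trajectory; for every $t\in[t^0,t^f]$ (at junctions: for each one-sided limit of $\boldsymbol a$) the gradients with respect to $\boldsymbol a$ of the components of $\boldsymbol g$ that vanish there are linearly independent; and the trajectory is normal, i.e. with $H_0=\boldsymbol\lambda^T\boldsymbol I(\boldsymbol s,\boldsymbol a)+\boldsymbol\mu^T\boldsymbol g(\boldsymbol s,\boldsymbol a,t)$ (the Hamiltonian without the running cost) the only continuous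 $\boldsymbol\lambda$ on $[t^0,t^f]$, $\boldsymbol\mu\ge 0$ and $\boldsymbol\nu\in\mathbb R^b$ satisfying $\boldsymbol\mu^T\boldsymbol g=0$, $-\dot{\boldsymbol\lambda}^T=\partial H_0/\partial\boldsymbol s$ and $0=\partial H_0/\partial\boldsymbol a$ on the open arcs, $\boldsymbol\lambda(t^0)^T=-\boldsymbol\nu^T\,\partial\boldsymbol\beta/\partial\boldsymbol s(t^0)$ and $\boldsymbol\lambda(t^f)^T=\boldsymbol\nu^T\,\partial\boldsymbol\beta/\partial\boldsymbol s(t^f)$ are $\boldsymbol\lambda=0$, $\boldsymbol\mu=0$, $\boldsymbol\nu=0$. Then there is a multiplier $\boldsymbol\mu$, with values in $\mathbb R^c$ and of class $C^r$ on each open arc, such that on each open arc $\mu_j\ge 0$ and $\mu_j g_j=0$ for all $j$, and for every $i=1,\dots,m$ the functions $\Psi_{y_i^{(n)}}+\boldsymbol\mu^T\boldsymbol g_{y_i^{(n)}}$ of time along the trajectory are $n$ times continuously differentiable for $n\le k_i$ and $$\sum_{n=0}^{k_i}(-1)^n\frac{d^n}{dt^n}\Big(\Psi_{y_i^{(n)}}+\boldsymbol\mu^T\boldsymbol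 g_{y_i^{(n)}}\Big)=0 .$$ -/

import Mathlib

open Set

/-- States of `m` integrator chains, chain `i` having length `k i`: the coordinate `⟨i, j⟩`,
`j < k i`, is the `j`-th derivative of the `i`-th output. -/
abbrev FlatState {m : ℕ} (k : Fin m → ℕ) : Type := (Σ i : Fin m, Fin (k i)) → ℝ

/-- Controls: the coordinate `i` is the derivative of order `k i` of the `i`-th output. -/
abbrev FlatControl (m : ℕ) : Type := Fin m → ℝ

/-- The integrator dynamics: each coordinate of the state is driven by the next derivative of
the same output, the last one in each chain by the control. -/
def integrator {m : ℕ} (k : Fin m → ℕ) (s : FlatState k) (a : FlatControl m) : FlatState k :=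
  fun q => if h : (q.2 : ℕ) + 1 < k q.1 then s ⟨q.1, ⟨(q.2 : ℕ) + 1, h⟩⟩ else a q.1

/-- The coordinate direction of the `n`-th derivative of the `i`-th output (`n ≤ k i`) in the
space of pairs (state, control). -/
def jetDir {m : ℕ} (k : Fin m → ℕ) (i : Fin m) (n : ℕ) : FlatState k × FlatControl m :=
  if h : n < k i then (Pi.single ⟨i, ⟨n, h⟩⟩ 1, 0) else (0, Pi.single i 1)

/-- The partial derivative of `F` with respect to the `n`-th derivative of the `i`-th output. -/
noncomputable def jetPartial {m : ℕ} {k : Fin m → ℕ} (F : FlatState k × FlatControl m → ℝ)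
    (i : Fin m) (n : ℕ) (z : FlatState k × FlatControl m) : ℝ :=
  fderiv ℝ F z (jetDir k i n)

/-- Data of an optimal control problem in the flat space, with `c` trajectory constraints and
`b` scalar boundary conditions. -/
structure FlatProblem {m : ℕ} (k : Fin m → ℕ) (c b : ℕ) where
  /-- initial time -/
  t0 : ℝ
  /-- final time -/
  tf : ℝ
  /-- the part of the flat space on which the problem is posed -/
  domain : Set (FlatState k × FlatControl m)
  /-- running cost -/
  Psi : FlatState k × FlatControl m → ℝ
  /-- final cost -/
  Phi : FlatState k × FlatControl m → ℝ
  /-- trajectory constraints `g (s, a) t ≤ 0` -/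
  g : FlatState k × FlatControl m → ℝ → Fin c → ℝ
  /-- initial and final conditions `bdry (s(t0), s(tf)) = 0` -/
  bdry : FlatState k × FlatState k → Fin b → ℝ

/-- A state trajectory with a piecewise continuous control. There are `N` pieces; on the closed
interval `[τ l, τ (l + 1)]`, `l < N`, the control is `a l` (at an interior junction `τ l` the two
values `a (l - 1) (τ l)` and `a l (τ l)` are the one-sided limits of the control). -/
structure FlatTrajectory {m : ℕ} (k : Fin m → ℕ) where
  /-- number of pieces -/
  N : ℕ
  /-- junction times -/
  τ : ℕ → ℝ
  /-- state -/
  s : ℝ → FlatState k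
  /-- pieces of the control -/
  a : ℕ → ℝ → FlatControl m

namespace FlatTrajectory

variable {m : ℕ} {k : Fin m → ℕ}

/-- State and control at time `t` in the `l`-th piece. -/
def point (p : FlatTrajectory k) (l : ℕ) (t : ℝ) : FlatState k × FlatControl m :=
  (p.s t, p.a l t)

/-- The `l`-th arc without its end points. -/
def openArc (p : FlatTrajectory k) (l : ℕ) : Set ℝ := Ioo (p.τ l) (p.τ (l + 1))

/-- The `l`-th arc with its end points. -/
def closedArc (p : FlatTrajectory k) (l : ℕ) : Set ℝ := Icc (p.τ l) (p.τ (l + 1))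

end FlatTrajectory

namespace FlatProblem

variable {m : ℕ} {k : Fin m → ℕ} {c b : ℕ}

/-- `p` satisfies the integrator dynamics, the trajectory constraints and the initial and final
conditions, and has a piecewise continuous control. -/
structure IsFeasible (P : FlatProblem k c b) (p : FlatTrajectory k) : Prop where
  tau_zero : p.τ 0 = P.t0
  tau_last : p.τ p.N = P.tf
  tau_lt : ∀ l < p.N, p.τ l < p.τ (l + 1)
  continuousOn_control : ∀ l < p.N, ContinuousOn (p.a l) (p.closedArc l)
  mem_domain : ∀ l < p.N, ∀ t ∈ p.closedArc l, p.point l t ∈ P.domain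
  dynamics : ∀ l < p.N, ∀ t ∈ p.closedArc l,
    HasDerivWithinAt p.s (integrator k (p.s t) (p.a l t)) (p.closedArc l) t
  constraint : ∀ l < p.N, ∀ t ∈ p.closedArc l, ∀ j, P.g (p.point l t) t j ≤ 0
  boundary : P.bdry (p.s P.t0, p.s P.tf) = 0

/-- The total cost: final cost plus integral of the running cost. -/
noncomputable def cost (P : FlatProblem k c b) (p : FlatTrajectory k) : ℝ :=
  P.Phi (p.point (p.N - 1) P.tf) +
    ∑ l ∈ Finset.range p.N, ∫ t in (p.τ l)..(p.τ (l + 1)), P.Psi (p.point l t)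

/-- `p` minimizes the total cost among all feasible trajectories. -/
def IsOptimal (P : FlatProblem k c b) (p : FlatTrajectory k) : Prop :=
  P.IsFeasible p ∧ ∀ q : FlatTrajectory k, P.IsFeasible q → P.cost p ≤ P.cost q

/-- The Hamiltonian with the cost left out, `λᵀ I(s, a) + μᵀ g(s, a, t)`. -/
def abnormalHamiltonian (P : FlatProblem k c b) (lam : FlatState k) (mu : Fin c → ℝ) (t : ℝ)
    (z : FlatState k × FlatControl m) : ℝ :=
  ∑ q, lam q * integrator k z.1 z.2 q + ∑ j, mu j * P.g z t j

/-- `(lam, mu, nu)` are multipliers of the dynamics, of the trajectory constraints and of the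
boundary conditions that satisfy, along `p`, the Euler-Lagrange equations, the sign and
complementarity conditions and the transversality conditions with cost multiplier `0`. -/
structure IsAbnormalMultiplier (P : FlatProblem k c b) (p : FlatTrajectory k)
    (lam : ℝ → FlatState k) (mu : ℕ → ℝ → Fin c → ℝ) (nu : Fin b → ℝ) : Prop where
  continuousOn_costate : ContinuousOn lam (Icc P.t0 P.tf)
  adjoint : ∀ l < p.N, ∀ t ∈ p.openArc l, ∀ (i : Fin m) (n : Fin (k i)),
    HasDerivAt (fun x => lam x ⟨i, n⟩)
      (-jetPartial (P.abnormalHamiltonian (lam t) (mu l t) t) i n (p.point l t)) t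
  stationary : ∀ l < p.N, ∀ t ∈ p.openArc l, ∀ i : Fin m,
    jetPartial (P.abnormalHamiltonian (lam t) (mu l t) t) i (k i) (p.point l t) = 0
  nonneg : ∀ l < p.N, ∀ t ∈ p.openArc l, ∀ j, 0 ≤ mu l t j
  complementary : ∀ l < p.N, ∀ t ∈ p.openArc l, ∀ j, mu l t j * P.g (p.point l t) t j = 0
  transversality_initial : ∀ d : FlatState k, ∑ q, lam P.t0 q * d q =
    -∑ e, nu e * fderiv ℝ P.bdry (p.s P.t0, p.s P.tf) (d, 0) e
  transversality_final : ∀ d : FlatState k, ∑ q, lam P.tf q * d q =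
    ∑ e, nu e * fderiv ℝ P.bdry (p.s P.t0, p.s P.tf) (0, d) e

/-- `p` is normal: no nontrivial multipliers have cost multiplier `0`. -/
def IsNormal (P : FlatProblem k c b) (p : FlatTrajectory k) : Prop :=
  ∀ lam mu nu, P.IsAbnormalMultiplier p lam mu nu →
    (∀ t ∈ Icc P.t0 P.tf, lam t = 0) ∧
      (∀ l < p.N, ∀ t ∈ p.openArc l, mu l t = 0) ∧ nu = 0

/-- The gradients with respect to the control of the constraints that are active along `p`
(one-sided limits at the junctions included) are linearly independent. -/
def ActiveGradientsIndependent (P : FlatProblem k c b) (p : FlatTrajectory k) : Prop :=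
  ∀ l < p.N, ∀ t ∈ p.closedArc l,
    LinearIndependent ℝ (fun (j : {j : Fin c // P.g (p.point l t) t j = 0}) (i : Fin m) =>
      jetPartial (fun z => P.g z t j) i (k i) (p.point l t))

/-- On each arc of `p` the set of active constraints is constant. -/
def ActiveSetConstant (P : FlatProblem k c b) (p : FlatTrajectory k) : Prop :=
  ∀ l < p.N, ∀ j, (∀ t ∈ p.openArc l, P.g (p.point l t) t j = 0) ∨
    (∀ t ∈ p.openArc l, P.g (p.point l t) t j < 0)

/-- `Ψ_{y_i^{(n)}} + μᵀ g_{y_i^{(n)}}` as a function of time along the `l`-th arc of `p`. -/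
noncomputable def lagrangianPartial (P : FlatProblem k c b) (p : FlatTrajectory k)
    (mu : ℕ → ℝ → Fin c → ℝ) (l : ℕ) (i : Fin m) (n : ℕ) (t : ℝ) : ℝ :=
  jetPartial P.Psi i n (p.point l t) +
    ∑ j, mu l t j * jetPartial (fun z => P.g z t j) i n (p.point l t)

end FlatProblem

/-! The equation is stationarity of the Hamiltonian with the costates eliminated. Let a chain have
length `K` and put `Q_n = Ψ_{y^(n)} + μᵀ g_{y^(n)}`. With cost multiplier `1`, the costate `λ_n` of
the equation `(y^(n-1))' = y^(n)` satisfies `λ_{n+1}' = -(λ_n + Q_n)`, where `λ_0 = 0` because no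
state derivative equals `y` itself, and stationarity reads `λ_K + Q_K = 0`. Solving downwards from
`n = K` writes `λ_0` as an alternating sum of derivatives of the `Q_n`
(`costate_eq_alternating_sum`), and `λ_0 = 0` is the claim. The differentiations are legitimate:
stationarity, independent active gradients and a constant active set make `μ` as smooth as the
costate, and the adjoint equation makes the costate one order smoother, as far as the data allow.

The multipliers come from first-order optimality. The dynamics are linear, so differences of
trajectories with fixed junctions form a vector space. Along a variation that is tangent to the
boundary conditions and strictly decreases the active constraints, small steps can be corrected to
feasible ones if the linearized boundary map is onto; hence the cost derivative is nonnegative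
(`IsOptimal.costDeriv_nonneg`). Only finitely many equations are left, and separation in finite
dimension gives `nu` and `lam₀ ≥ 0`, not both zero (`exists_fritzJohn_multipliers`).

The integrated inequality becomes pointwise in `exists_adjoint_of_nonneg`. Independence of the
control gradients yields a continuous feedback `K` annihilated by the active forms. With `u = K σ +
w` the constraints see only `w`, and the costate of the closed-loop system removes `σ` from the
functional by parts. Free initial values give transversality, localized `w` give a sign condition at
each time, and Farkas' lemma turns it into `μ`. Normality excludes `lam₀ = 0`, so one may divide by
it. -/

section
open Filter Topology

/-! ### Linear differential equations with piecewise continuous coefficients. -/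

section LinearODE
variable {E : Type*} [NormedAddCommGroup E] [NormedSpace ℝ E]

/-- On `[a, b]` the linear equation `x' = M x + f` has solutions with any prescribed value at
either end point. -/
def LinearlySolvable (M : ℝ → E →L[ℝ] E) (f : ℝ → E) (a b : ℝ) : Prop :=
  ∀ x₀ : E, ∀ e ∈ ({a, b} : Set ℝ), ∃ x : ℝ → E, x e = x₀ ∧
    ∀ t ∈ Icc a b, HasDerivWithinAt x (M t (x t) + f t) (Icc a b) t

theorem LinearlySolvable.of_short [CompleteSpace E] {M : ℝ → E →L[ℝ] E} {f : ℝ → E} {a b K C : ℝ}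
    (hab : a ≤ b) (hM : ContinuousOn M (Icc a b)) (hf : ContinuousOn f (Icc a b))
    (hK : ∀ t ∈ Icc a b, ‖M t‖ ≤ K) (hC : ∀ t ∈ Icc a b, ‖f t‖ ≤ C) (hshort : K * (b - a) ≤ 1 / 2) :
    LinearlySolvable M f a b := by
  intro x₀ e he
  have hK0 : 0 ≤ K := (norm_nonneg _).trans (hK a ⟨le_rfl, hab⟩)
  have hC0 : 0 ≤ C := (norm_nonneg _).trans (hC a ⟨le_rfl, hab⟩)
  have he' : e ∈ Icc a b := by
    rcases he with rfl | rfl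
    · exact ⟨le_rfl, hab⟩
    · exact ⟨hab, le_rfl⟩
  have hba : 0 ≤ b - a := sub_nonneg.2 hab
  -- On the ball of radius `R` the field is bounded by `K (‖x₀‖ + R) + C`; times `b - a` this is at
  -- most `R / 2 + R / 2`, so Picard–Lindelöf covers all of `[a, b]`.
  set R : ℝ := 2 * (K * ‖x₀‖ + C) * (b - a) with hR
  have hR0 : 0 ≤ R := by positivity
  have hL0 : 0 ≤ K * (‖x₀‖ + R) + C := by positivity
  have hPL : IsPicardLindelof (fun t x => M t x + f t) (⟨e, he'⟩ : Icc a b) x₀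
      ⟨R, hR0⟩ 0 ⟨K * (‖x₀‖ + R) + C, hL0⟩ ⟨K, hK0⟩ := by
    refine ⟨fun t ht => ?_, fun x _ => ?_, fun t ht x hx => ?_, ?_⟩
    · refine LipschitzOnWith.of_dist_le_mul fun x _ y _ => ?_
      rw [dist_add_right, dist_eq_norm, dist_eq_norm, ← map_sub]
      exact (M t).le_of_opNorm_le (hK t ht) _
    · exact (hM.clm_apply continuousOn_const).add hf
    · have hx' : ‖x‖ ≤ ‖x₀‖ + R := by
        have h1 : ‖x - x₀‖ ≤ R := (dist_eq_norm x x₀).symm.trans_le (Metric.mem_closedBall.1 hx)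
        have := norm_add_le x₀ (x - x₀)
        simp only [add_sub_cancel] at this
        linarith
      calc ‖M t x + f t‖ ≤ ‖M t x‖ + ‖f t‖ := norm_add_le _ _
        _ ≤ K * (‖x₀‖ + R) + C :=
          add_le_add (((M t).le_of_opNorm_le (hK t ht) _).trans (by gcongr)) (hC t ht)
    · have h1 : max (b - e) (e - a) ≤ b - a :=
        max_le (by linarith [he'.1]) (by linarith [he'.2])
      have h2 : (K * (‖x₀‖ + R) + C) * max (b - e) (e - a) ≤ (K * (‖x₀‖ + R) + C) * (b - a) := by
        gcongr
      have h3 : (K * (b - a)) * R ≤ 1 / 2 * R := by gcongr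
      change (K * (‖x₀‖ + R) + C) * max (b - e) (e - a) ≤ R - 0
      nlinarith
  obtain ⟨x, hx0, hx⟩ := hPL.exists_eq_forall_mem_Icc_hasDerivWithinAt₀
  exact ⟨x, hx0, hx⟩

theorem LinearlySolvable.trans {M : ℝ → E →L[ℝ] E} {f : ℝ → E} {a b c : ℝ} (hab : a ≤ b)
    (hbc : b ≤ c) (h1 : LinearlySolvable M f a b) (h2 : LinearlySolvable M f b c) :
    LinearlySolvable M f a c := by
  have glue : ∀ x y : ℝ → E, x b = y b →
      (∀ t ∈ Icc a b, HasDerivWithinAt x (M t (x t) + f t) (Icc a b) t) →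
      (∀ t ∈ Icc b c, HasDerivWithinAt y (M t (y t) + f t) (Icc b c) t) →
      ∃ z : ℝ → E, z a = x a ∧ z c = y c ∧
        ∀ t ∈ Icc a c, HasDerivWithinAt z (M t (z t) + f t) (Icc a c) t := by
    intro x y hb hx hy
    set z : ℝ → E := fun t => if t ≤ b then x t else y t with hz
    have zx : ∀ t ≤ b, z t = x t := fun t ht => if_pos ht
    have zy : ∀ t, b ≤ t → z t = y t := by
      intro t ht
      rcases ht.eq_or_lt with rfl | h
      · rw [zx _ le_rfl, hb]
      · exact if_neg (not_le.2 h)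
    refine ⟨z, zx a hab, zy c hbc, ?_⟩
    have hzx : ∀ t ∈ Icc a b, HasDerivWithinAt z (M t (z t) + f t) (Icc a b) t := fun t ht => by
      rw [zx t ht.2]
      exact (hx t ht).congr (fun s hs => zx s hs.2) (zx t ht.2)
    have hzy : ∀ t ∈ Icc b c, HasDerivWithinAt z (M t (z t) + f t) (Icc b c) t := fun t ht => by
      rw [zy t ht.1]
      exact (hy t ht).congr (fun s hs => zy s hs.1) (zy t ht.1)
    intro t ht
    rw [← Icc_union_Icc_eq_Icc hab hbc]
    rcases lt_trichotomy t b with h | rfl | h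
    · refine (hzx t ⟨ht.1, h.le⟩).union (HasFDerivWithinAt.of_notMem_closure ?_)
      rw [closure_Icc]
      exact fun h' => absurd h'.1 (not_le.2 h)
    · exact (hzx t ⟨hab, le_rfl⟩).union (hzy t ⟨le_rfl, hbc⟩)
    · refine HasDerivWithinAt.union (HasFDerivWithinAt.of_notMem_closure ?_) (hzy t ⟨h.le, ht.2⟩)
      rw [closure_Icc]
      exact fun h' => absurd h'.2 (not_le.2 h)
  intro x₀ e he
  rcases he with rfl | rfl
  · obtain ⟨x, hx0, hx⟩ := h1 x₀ e (by simp)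
    obtain ⟨y, hy0, hy⟩ := h2 (x b) b (by simp)
    obtain ⟨z, hza, -, hz⟩ := glue x y hy0.symm hx hy
    exact ⟨z, hza.trans hx0, hz⟩
  · obtain ⟨y, hy0, hy⟩ := h2 x₀ e (by simp)
    obtain ⟨x, hx0, hx⟩ := h1 (y b) b (by simp)
    obtain ⟨z, -, hzc, hz⟩ := glue x y hx0 hx hy
    exact ⟨z, hzc.trans hy0, hz⟩

/-- By linearity the length of an interval of solvability depends on the bound of `M` alone, not on
the prescribed value, so short intervals can be concatenated. -/
theorem LinearlySolvable.of_continuousOn [CompleteSpace E] {M : ℝ → E →L[ℝ] E} {f : ℝ → E}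
    {a b : ℝ} (hab : a ≤ b) (hM : ContinuousOn M (Icc a b)) (hf : ContinuousOn f (Icc a b)) :
    LinearlySolvable M f a b := by
  obtain ⟨K, hK⟩ := isCompact_Icc.exists_bound_of_continuousOn hM
  obtain ⟨C, hC⟩ := isCompact_Icc.exists_bound_of_continuousOn hf
  have hK0 : 0 ≤ K := (norm_nonneg _).trans (hK a ⟨le_rfl, hab⟩)
  have key : ∀ n : ℕ, ∀ c ∈ Icc a b, K * (c - a) ≤ n / 2 → LinearlySolvable M f a c := by
    intro n
    induction n with
    | zero =>
      intro c hc h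
      have hsub : Icc a c ⊆ Icc a b := Icc_subset_Icc_right hc.2
      refine .of_short hc.1 (hM.mono hsub) (hf.mono hsub) (fun t ht => hK t (hsub ht))
        (fun t ht => hC t (hsub ht)) ?_
      push_cast at h
      linarith
    | succ n ih =>
      intro c hc h
      -- Cutting off the last `1 / (n + 1)` of the interval leaves the bounds `n / 2` on the left
      -- piece and `1 / 2` on the right one.
      set d : ℝ := a + (c - a) * (n / (n + 1)) with hd
      have hq0 : (0 : ℝ) ≤ n / (n + 1) := by positivity
      have hq : (1 : ℝ) - n / (n + 1) = 1 / (n + 1) := by field_simp; ring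
      have hq1 : (n : ℝ) / (n + 1) ≤ 1 := by
        have : (0 : ℝ) ≤ 1 / (n + 1) := by positivity
        linarith
      have hca : 0 ≤ c - a := sub_nonneg.2 hc.1
      have had : a ≤ d := by have := mul_nonneg hca hq0; linarith
      have hdc : d ≤ c := by have := mul_le_mul_of_nonneg_left hq1 hca; linarith
      push_cast at h
      have h1 : K * (d - a) ≤ n / 2 := by
        calc K * (d - a) = K * (c - a) * (n / (n + 1)) := by rw [hd]; ring
          _ ≤ ((n + 1) / 2) * (n / (n + 1)) := by gcongr
          _ = n / 2 := by field_simp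
      have h2 : K * (c - d) ≤ 1 / 2 := by
        calc K * (c - d) = K * (c - a) * (1 - n / (n + 1)) := by rw [hd]; ring
          _ = K * (c - a) * (1 / (n + 1)) := by rw [hq]
          _ ≤ ((n + 1) / 2) * (1 / (n + 1)) := by gcongr
          _ = 1 / 2 := by field_simp
      have hsub : Icc d c ⊆ Icc a b := Icc_subset_Icc had hc.2
      exact (ih d ⟨had, hdc.trans hc.2⟩ h1).trans had hdc (.of_short hdc (hM.mono hsub)
        (hf.mono hsub) (fun t ht => hK t (hsub ht)) (fun t ht => hC t (hsub ht)) h2)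
  obtain ⟨n, hn⟩ := exists_nat_ge (2 * (K * (b - a)))
  exact key n b ⟨hab, le_rfl⟩ (by linarith)

theorem monotone_junctions {τ : ℕ → ℝ} {N : ℕ} (hτ : ∀ l < N, τ l < τ (l + 1)) {i j : ℕ}
    (hij : i ≤ j) (hj : j ≤ N) : τ i ≤ τ j := by
  induction j, hij using Nat.le_induction with
  | base => exact le_rfl
  | succ j hij ih => exact (ih (by omega)).trans (hτ j (by omega)).le

theorem exists_forward_piecewise_solution [CompleteSpace E] {N : ℕ} {τ : ℕ → ℝ}
    (hτ : ∀ l < N, τ l < τ (l + 1)) {M : ℕ → ℝ → E →L[ℝ] E} {f : ℕ → ℝ → E}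
    (hM : ∀ l < N, ContinuousOn (M l) (Icc (τ l) (τ (l + 1))))
    (hf : ∀ l < N, ContinuousOn (f l) (Icc (τ l) (τ (l + 1)))) (x₀ : E) :
    ∃ x : ℝ → E, x (τ 0) = x₀ ∧ ∀ l < N, ∀ t ∈ Icc (τ l) (τ (l + 1)),
      HasDerivWithinAt x (M l t (x t) + f l t) (Icc (τ l) (τ (l + 1))) t := by
  induction N with
  | zero => exact ⟨fun _ => x₀, rfl, fun l hl => absurd hl (by omega)⟩
  | succ N ih =>
    obtain ⟨x, hx0, hx⟩ := ih (fun l hl => hτ l (by omega)) (fun l hl => hM l (by omega))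
      (fun l hl => hf l (by omega))
    obtain ⟨y, hy0, hy⟩ := LinearlySolvable.of_continuousOn (hτ N (by omega)).le
      (hM N (by omega)) (hf N (by omega)) (x (τ N)) (τ N) (by simp)
    set z : ℝ → E := fun t => if t ≤ τ N then x t else y t with hz
    have zx : ∀ t ≤ τ N, z t = x t := fun t ht => if_pos ht
    have zy : ∀ t, τ N ≤ t → z t = y t := by
      intro t ht
      rcases ht.eq_or_lt with rfl | h
      · rw [zx _ le_rfl, hy0]
      · exact if_neg (not_le.2 h)
    refine ⟨z, (zx _ (monotone_junctions hτ (Nat.zero_le N) (by omega))).trans hx0, ?_⟩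
    intro l hl t ht
    rcases Nat.lt_succ_iff_lt_or_eq.1 hl with h | rfl
    · have hle : ∀ s ∈ Icc (τ l) (τ (l + 1)), s ≤ τ N := fun s hs =>
        hs.2.trans (monotone_junctions hτ (by omega) (by omega))
      rw [zx t (hle t ht)]
      exact (hx l h t ht).congr (fun s hs => zx s (hle s hs)) (zx t (hle t ht))
    · rw [zy t ht.1]
      exact (hy t ht).congr (fun s hs => zy s hs.1) (zy t ht.1)

theorem exists_backward_piecewise_solution [CompleteSpace E] {N : ℕ} {τ : ℕ → ℝ}
    (hτ : ∀ l < N, τ l < τ (l + 1)) {M : ℕ → ℝ → E →L[ℝ] E} {f : ℕ → ℝ → E}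
    (hM : ∀ l < N, ContinuousOn (M l) (Icc (τ l) (τ (l + 1))))
    (hf : ∀ l < N, ContinuousOn (f l) (Icc (τ l) (τ (l + 1)))) (x₀ : E) :
    ∃ x : ℝ → E, x (τ N) = x₀ ∧ ∀ l < N, ∀ t ∈ Icc (τ l) (τ (l + 1)),
      HasDerivWithinAt x (M l t (x t) + f l t) (Icc (τ l) (τ (l + 1))) t := by
  -- The first arc is split off and the others are renumbered, so the data vary in the induction.
  induction N generalizing τ M f with
  | zero => exact ⟨fun _ => x₀, rfl, fun l hl => absurd hl (by omega)⟩
  | succ N ih =>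
    obtain ⟨x, hx0, hx⟩ := ih (τ := fun l => τ (l + 1)) (M := fun l => M (l + 1))
      (f := fun l => f (l + 1)) (fun l hl => hτ (l + 1) (by omega))
      (fun l hl => hM (l + 1) (by omega)) (fun l hl => hf (l + 1) (by omega))
    obtain ⟨y, hy0, hy⟩ := LinearlySolvable.of_continuousOn (hτ 0 (by omega)).le
      (hM 0 (by omega)) (hf 0 (by omega)) (x (τ 1)) (τ 1) (by simp)
    set z : ℝ → E := fun t => if τ 1 ≤ t then x t else y t with hz
    have zx : ∀ t, τ 1 ≤ t → z t = x t := fun t ht => if_pos ht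
    have zy : ∀ t ≤ τ 1, z t = y t := by
      intro t ht
      rcases ht.eq_or_lt with rfl | h
      · rw [zx _ le_rfl, hy0]
      · exact if_neg (not_le.2 h)
    refine ⟨z, (zx _ (monotone_junctions hτ (by omega) le_rfl)).trans hx0, ?_⟩
    intro l hl t ht
    rcases Nat.eq_zero_or_pos l with rfl | h
    · rw [zy t ht.2]
      exact (hy t ht).congr (fun s hs => zy s hs.2) (zy t ht.2)
    · obtain ⟨l, rfl⟩ : ∃ k, l = k + 1 := ⟨l - 1, by omega⟩
      have hle : ∀ s ∈ Icc (τ (l + 1)) (τ (l + 1 + 1)), τ 1 ≤ s := fun s hs =>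
        (monotone_junctions hτ (by omega) (by omega)).trans hs.1
      rw [zx t (hle t ht)]
      exact (hx l (by omega) t ht).congr (fun s hs => zx s (hle s hs)) (zx t (hle t ht))

end LinearODE

/-! ### Right inverses of independent families of linear forms. -/

section RightInverse

variable {U : Type*} [NormedAddCommGroup U] [NormedSpace ℝ U] {ι : Type*} [Fintype ι]

/-- A functional vanishing on the range of `u ↦ (γ j u)`, `j ∈ A`, is a linear relation between
these forms, hence zero; so the map is onto and has a linear section. -/
theorem exists_right_inverse_of_linearIndependent (γ : ι → U →L[ℝ] ℝ) (A : Set ι)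
    (h : LinearIndependent ℝ (fun j : A => γ j)) :
    ∃ R : (ι → ℝ) →L[ℝ] U, ∀ e, ∀ j ∈ A, γ j (R e) = e j := by
  classical
  let G : U →ₗ[ℝ] (A → ℝ) := LinearMap.pi fun j => (γ j : U →ₗ[ℝ] ℝ)
  have hsurj : LinearMap.range G = ⊤ := by
    by_contra hne
    obtain ⟨φ, hφ, hle⟩ := Submodule.exists_le_ker_of_lt_top _ (lt_top_iff_ne_top.2 hne)
    refine hφ (LinearMap.pi_ext' fun j => LinearMap.ext_ring ?_)
    have h0 := Fintype.linearIndependent_iff.1 h (fun j => φ (Pi.single j 1)) (by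
      ext u
      have : φ (G u) = 0 := hle ⟨u, rfl⟩
      rw [← Finset.univ_sum_single (G u), map_sum] at this
      rw [sum_apply, zero_apply, ← this]
      refine Finset.sum_congr rfl fun i _ => ?_
      have h1 : (Pi.single i (G u i) : A → ℝ) = (γ i u) • Pi.single i 1 := by
        rw [← Pi.single_smul]; simp [G]
      rw [h1, map_smul, smul_apply, smul_eq_mul, smul_eq_mul, mul_comm])
    simpa using h0 j
  obtain ⟨S, hS⟩ := G.exists_rightInverse_of_surjective hsurj
  refine ⟨LinearMap.toContinuousLinearMap (S ∘ₗ LinearMap.funLeft ℝ ℝ ((↑) : A → ι)),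
    fun e j hj => ?_⟩
  have := congrFun (LinearMap.congr_fun hS (LinearMap.funLeft ℝ ℝ ((↑) : A → ι) e)) ⟨j, hj⟩
  simpa [G] using this

/-- The right inverse `R₀` at `t₀` is corrected by the inverse of `S t`, which has the rows `γ t j ∘
R₀` for `j ∈ A` and coordinate rows otherwise. Since `S t₀ = 1` and inversion is smooth near `1`,
the result is as smooth as `γ`. -/
theorem exists_local_right_inverse {n : WithTop ℕ∞} {T : Set ℝ} {t₀ : ℝ}
    {γ : ℝ → ι → U →L[ℝ] ℝ} (A : Set ι)
    (hγ : ∀ j, ContDiffWithinAt ℝ n (fun t => γ t j) T t₀)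
    (h : LinearIndependent ℝ (fun j : A => γ t₀ j)) :
    ∃ R : ℝ → (ι → ℝ) →L[ℝ] U, ContDiffWithinAt ℝ n R T t₀ ∧
      ∀ᶠ t in 𝓝[T] t₀, ∀ e, ∀ j ∈ A, γ t j (R t e) = e j := by
  classical
  obtain ⟨R₀, hR₀⟩ := exists_right_inverse_of_linearIndependent (γ t₀) A h
  let S : ℝ → (ι → ℝ) →L[ℝ] (ι → ℝ) := fun t => ContinuousLinearMap.pi fun j =>
    if j ∈ A then (γ t j).comp R₀ else ContinuousLinearMap.proj j
  have hS₀ : S t₀ = 1 := by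
    ext1 e
    funext j
    by_cases hj : j ∈ A
    · simp [S, hj, hR₀ e j hj]
    · simp [S, hj]
  have hS : ContDiffWithinAt ℝ n S T t₀ := by
    have : ContDiffWithinAt ℝ n (fun t => (fun j : ι =>
        if j ∈ A then (γ t j).comp R₀ else (ContinuousLinearMap.proj j : (ι → ℝ) →L[ℝ] ℝ))) T t₀ := by
      refine contDiffWithinAt_pi.2 fun j => ?_
      by_cases hj : j ∈ A
      · simp only [hj, if_true]
        exact (hγ j).clm_comp contDiffWithinAt_const
      · simp only [hj, if_false]
        exact contDiffWithinAt_const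
    exact (ContinuousLinearMap.piEquivL ℝ (ι → ℝ) (fun _ : ι => ℝ)).contDiff.comp_contDiffWithinAt this
  have hinv : ContDiffAt ℝ n Ring.inverse (S t₀) := by
    rw [hS₀]
    exact contDiffAt_ringInverse ℝ (1 : ((ι → ℝ) →L[ℝ] (ι → ℝ))ˣ)
  refine ⟨fun t => R₀.comp (Ring.inverse (S t)),
    contDiffWithinAt_const.clm_comp (hinv.comp_contDiffWithinAt t₀ hS), ?_⟩
  have hunit : ∀ᶠ t in 𝓝[T] t₀, IsUnit (S t) := by
    refine hS.continuousWithinAt.eventually_mem (Units.isOpen.mem_nhds ?_)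
    rw [hS₀]
    exact isUnit_one
  filter_upwards [hunit] with t ht e j hj
  have h1 : S t (Ring.inverse (S t) e) = e := by
    have := Ring.mul_inverse_cancel _ ht
    exact DFunLike.congr_fun this e
  have h2 := congrFun h1 j
  simpa [S, hj] using h2

end RightInverse

/-! ### Continuous selections of feedbacks and controls on an arc. -/

section Feedback
variable {E U : Type*} [NormedAddCommGroup E] [NormedSpace ℝ E]
  [NormedAddCommGroup U] [NormedSpace ℝ U] {ι : Type*} [Fintype ι]

/-- A continuous feedback that keeps the linear forms of the active indices at zero. -/
theorem exists_annihilating_feedback {a b : ℝ} (hab : a ≤ b) {γ : ℝ → ι → (E × U) →L[ℝ] ℝ}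
    {A : ℝ → Set ι} (hγ : ∀ j, ContinuousOn (fun t => γ t j) (Icc a b))
    (hA : ∀ t ∈ Icc a b, ∀ᶠ s in 𝓝[Icc a b] t, A s ⊆ A t)
    (hind : ∀ t ∈ Icc a b, LinearIndependent ℝ
      (fun j : A t => (γ t j).comp (ContinuousLinearMap.inr ℝ E U))) :
    ∃ K : ℝ → E →L[ℝ] U, Continuous K ∧ ∀ t ∈ Icc a b, ∀ j ∈ A t, ∀ d, γ t j (d, K t d) = 0 := by
  -- The admissible feedbacks at each time form a convex set, so local continuous choices can be
  -- glued by a partition of unity.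
  let S : Icc a b → Set (E →L[ℝ] U) := fun t => {K | ∀ j ∈ A t, ∀ d, γ t j (d, K d) = 0}
  have hconv : ∀ t, Convex ℝ (S t) := by
    intro t K hK L hL p q hp hq hpq j hj d
    have h1 : ((d, (p • K + q • L) d) : E × U) = p • (d, K d) + q • (d, L d) := by
      ext <;> simp [← add_smul, hpq]
    rw [h1, map_add, map_smul, map_smul, hK j hj d, hL j hj d]
    simp
  have hloc : ∀ t : Icc a b, ∃ V ∈ 𝓝 t, ∃ g : Icc a b → E →L[ℝ] U, ContinuousOn g V ∧
      ∀ s ∈ V, g s ∈ S s := by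
    intro ⟨t, ht⟩
    obtain ⟨R, hR, hRγ⟩ := exists_local_right_inverse (n := 0)
      (γ := fun t j => (γ t j).comp (ContinuousLinearMap.inr ℝ E U)) (A t)
      (fun j => ((contDiffOn_zero.2 ((hγ j).clm_comp continuousOn_const)) t ht)) (hind t ht)
    obtain ⟨V, hV, hRV⟩ := (contDiffWithinAt_zero ht).1 hR
    have hev := (hRγ.and (hA t ht)).and hV
    -- The control part is chosen to cancel `γ s j (d, 0)`. No new index becomes active near `t`, so
    -- the right inverse for `A t` also serves `A s`.
    let g : ℝ → E →L[ℝ] U := fun s => -(R s).comp (ContinuousLinearMap.pi fun j =>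
      (γ s j).comp (ContinuousLinearMap.inl ℝ E U))
    rw [nhdsWithin_eq_map_subtype_coe ht] at hev
    refine ⟨_, eventually_map.1 hev, fun s => g s, ?_, fun s hs j hj d => ?_⟩
    · have hval : ContinuousOn (Subtype.val : Icc a b → ℝ)
          {s | ((∀ e, ∀ j ∈ A t, ((γ s j).comp (ContinuousLinearMap.inr ℝ E U)) (R s e) = e j) ∧
            A s ⊆ A t) ∧ (s : ℝ) ∈ V} := continuous_subtype_val.continuousOn
      have h1 := hRV.comp hval fun s hs => ⟨s.2, hs.2⟩
      have h2 : ContinuousOn (fun s : Icc a b => fun j =>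
          (γ s j).comp (ContinuousLinearMap.inl ℝ E U)) univ :=
        continuousOn_pi.2 fun j => ((hγ j).comp continuous_subtype_val.continuousOn
          fun s _ => s.2).clm_comp continuousOn_const
      have h3 := (ContinuousLinearMap.piEquivL ℝ E (fun _ : ι => ℝ)).continuous.comp_continuousOn h2
      exact (h1.clm_comp (h3.mono (subset_univ _))).neg
    · have h1 := hs.1.1 (fun i => γ s i (d, 0)) j (hs.1.2 hj)
      have h2 : ((d, g s d) : E × U) = (d, 0) - (0, R s (fun i => γ s i (d, 0))) := by
        ext <;> simp [g]
      rw [h2, map_sub, sub_eq_zero, ← h1]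
      rfl
  obtain ⟨K, hK⟩ := exists_continuous_forall_mem_convex_of_local hconv hloc
  refine ⟨IccExtend hab K, K.continuous.Icc_extend', fun t ht j hj d => ?_⟩
  rw [IccExtend_of_mem hab K ht]
  exact hK ⟨t, ht⟩ j hj d

/-- A continuous control along which the linear forms of the active indices are negative. -/
theorem exists_strict_control {a b : ℝ} (hab : a ≤ b) {γ : ℝ → ι → U →L[ℝ] ℝ}
    {A : ℝ → Set ι} (hγ : ∀ j, ContinuousOn (fun t => γ t j) (Icc a b))
    (hA : ∀ t ∈ Icc a b, ∀ᶠ s in 𝓝[Icc a b] t, A s ⊆ A t)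
    (hind : ∀ t ∈ Icc a b, LinearIndependent ℝ (fun j : A t => γ t j)) :
    ∃ w : ℝ → U, Continuous w ∧ ∀ t ∈ Icc a b, ∀ j ∈ A t, γ t j (w t) < 0 := by
  let S : Icc a b → Set U := fun t => {w | ∀ j ∈ A t, γ t j w < 0}
  have hconv : ∀ t, Convex ℝ (S t) := by
    intro t x hx y hy p q hp hq hpq j hj
    have h1 := hx j hj
    have h2 := hy j hj
    rw [map_add, map_smul, map_smul, smul_eq_mul, smul_eq_mul]
    rcases hp.eq_or_lt with rfl | hp'
    · rw [zero_add] at hpq; subst hpq; simpa using h2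
    · nlinarith
  have hloc : ∀ t : Icc a b, ∃ w, ∀ᶠ s in 𝓝 t, w ∈ S s := by
    intro ⟨t, ht⟩
    obtain ⟨R, hR⟩ := exists_right_inverse_of_linearIndependent (γ t) (A t) (hind t ht)
    -- All forms active at `t` take the value `-1` on this control; they stay negative nearby, so a
    -- locally constant choice suffices.
    refine ⟨R (fun _ => -1), ?_⟩
    have h1 : ∀ᶠ s in 𝓝[Icc a b] t, ∀ j ∈ A t, γ s j (R fun _ => -1) < 0 := by
      refine eventually_all.2 fun j => ?_
      by_cases hj : j ∈ A t
      · have hc : ContinuousWithinAt (fun s => γ s j (R fun _ => -1)) (Icc a b) t :=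
          ((hγ j).clm_apply continuousOn_const) t ht
        have := hc.eventually (gt_mem_nhds (show γ t j (R fun _ => -1) < 0 by
          rw [hR _ j hj]; norm_num))
        filter_upwards [this] with s hs _ using hs
      · exact Eventually.of_forall fun s h => absurd h hj
    have h2 := h1.and (hA t ht)
    rw [nhdsWithin_eq_map_subtype_coe ht] at h2
    filter_upwards [eventually_map.1 h2] with s hs j hj
    exact hs.1 j (hs.2 hj)
  obtain ⟨w, hw⟩ := exists_continuous_forall_mem_convex_of_local_const hconv hloc
  refine ⟨IccExtend hab w, w.continuous.Icc_extend', fun t ht j hj => ?_⟩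
  rw [IccExtend_of_mem hab w ht]
  exact hw ⟨t, ht⟩ j hj

end Feedback

/-! ### Farkas' lemma for independent forms, and limit arguments. -/

/-- By independence the active forms take arbitrary values, and `h` vanishes on their common kernel.
Hence `h` factors through them, with coefficient `-μ j` equal to the value of `h` on a vector where
only the `j`-th form is `1`. -/
theorem exists_nonneg_multiplier {U : Type*} [NormedAddCommGroup U] [NormedSpace ℝ U]
    {ι : Type*} [Fintype ι] (γ : ι → U →L[ℝ] ℝ) (A : Set ι)
    (hind : LinearIndependent ℝ (fun j : A => γ j)) (h : U →L[ℝ] ℝ)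
    (hh : ∀ w, (∀ j ∈ A, γ j w ≤ 0) → 0 ≤ h w) :
    ∃ μ : ι → ℝ, (∀ j, 0 ≤ μ j) ∧ (∀ j, j ∉ A → μ j = 0) ∧ h + ∑ j, μ j • γ j = 0 := by
  classical
  obtain ⟨R, hR⟩ := exists_right_inverse_of_linearIndependent γ A hind
  have hzero : ∀ w, (∀ j ∈ A, γ j w = 0) → h w = 0 := fun w hw => by
    refine le_antisymm ?_ (hh w fun j hj => (hw j hj).le)
    have := hh (-w) fun j hj => by rw [map_neg, hw j hj, neg_zero]
    rwa [map_neg, Left.nonneg_neg_iff] at this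
  have hout : ∀ j, j ∉ A → h (R (Pi.single j 1)) = 0 := fun j hj => by
    refine hzero _ fun i hi => ?_
    rw [hR _ i hi, Pi.single_eq_of_ne]
    rintro rfl
    exact hj hi
  refine ⟨fun j => -h (R (Pi.single j 1)), fun j => ?_, fun j hj => neg_eq_zero.2 (hout j hj), ?_⟩
  · change 0 ≤ -h _
    rw [← map_neg, ← map_neg]
    refine hh _ fun i hi => ?_
    rw [hR _ i hi, Pi.neg_apply, Left.neg_nonpos_iff, Pi.single_apply]
    split_ifs <;> norm_num
  · ext v
    have h1 := hzero (v - R fun i => γ i v) fun j hj => by rw [map_sub, hR _ j hj, sub_self]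
    rw [map_sub, sub_eq_zero] at h1
    have h2 : (fun i => γ i v) = ∑ i, γ i v • (Pi.single i 1 : ι → ℝ) := by
      rw [← Finset.univ_sum_single (fun i => γ i v)]
      refine Finset.sum_congr rfl fun i _ => ?_
      rw [← Pi.single_smul]
      simp
    rw [h2, map_sum, map_sum] at h1
    simp only [map_smul, smul_eq_mul] at h1
    simp only [_root_.add_apply, sum_apply, smul_apply, smul_eq_mul, h1, _root_.zero_apply,
      ← Finset.sum_add_distrib]
    exact Finset.sum_eq_zero fun i _ => by ring

theorem eq_zero_of_forall_mul_add_nonneg {x c : ℝ} (h : ∀ M : ℝ, 0 ≤ M * x + c) : x = 0 := by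
  by_contra hx
  have := h (-(c + 1) / x)
  rw [div_mul_cancel₀ _ hx] at this
  linarith

theorem nonneg_of_forall_mul_add_nonneg {x c : ℝ} (h : ∀ M : ℝ, 0 ≤ M → 0 ≤ M * x + c) :
    0 ≤ x := by
  by_contra! hx
  have h1 := h ((|c| + 1) / -x) (div_nonneg (by positivity) (by linarith))
  have h2 : (|c| + 1) / -x * x = -(|c| + 1) := by
    have : x ≠ 0 := hx.ne
    field_simp
  have := le_abs_self c
  linarith

theorem nonneg_of_forall_pos_add_mul_nonneg {x c : ℝ} (h : ∀ κ : ℝ, 0 < κ → 0 ≤ x + κ * c) :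
    0 ≤ x := by
  have h1 : Tendsto (fun κ : ℝ => x + κ * c) (𝓝[>] 0) (𝓝 (x + 0 * c)) :=
    (tendsto_const_nhds.add (tendsto_id.mul_const c)).mono_left nhdsWithin_le_nhds
  rw [zero_mul, add_zero] at h1
  exact ge_of_tendsto h1 (eventually_mem_nhdsWithin.mono fun κ hκ => h κ hκ)

theorem continuousOn_Icc_of_arcs {F : Type*} [TopologicalSpace F] {N : ℕ} {τ : ℕ → ℝ}
    (hτ : ∀ l < N, τ l < τ (l + 1)) {f : ℝ → F} (hN : 0 < N)
    (hf : ∀ l < N, ContinuousOn f (Icc (τ l) (τ (l + 1)))) : ContinuousOn f (Icc (τ 0) (τ N)) := by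
  induction N, hN using Nat.le_induction with
  | base => exact hf 0 (by omega)
  | succ n hn ih =>
    rw [← Icc_union_Icc_eq_Icc (monotone_junctions hτ (Nat.zero_le n) (by omega))
      (hτ n (by omega)).le]
    exact (ih (fun l hl => hτ l (by omega)) (fun l hl => hf l (by omega))).union_of_isClosed
      (hf n (by omega)) isClosed_Icc isClosed_Icc

/-! ### Adjoint arc and multipliers of a linear control problem. -/

section Core
variable {E U : Type*} [NormedAddCommGroup E] [NormedSpace ℝ E] [NormedAddCommGroup U]
  [NormedSpace ℝ U]

/-- A trajectory of the linear control system `σ' = I (σ, u)` whose control is continuous on each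
of the arcs `[τ l, τ (l + 1)]`, `l < N`. -/
def IsLinearTrajectory (I : E × U →L[ℝ] E) (N : ℕ) (τ : ℕ → ℝ) (σ : ℝ → E) (u : ℕ → ℝ → U) :
    Prop :=
  ∀ l < N, ContinuousOn (u l) (Icc (τ l) (τ (l + 1))) ∧ ∀ t ∈ Icc (τ l) (τ (l + 1)),
    HasDerivWithinAt σ (I (σ t, u l t)) (Icc (τ l) (τ (l + 1))) t

theorem IsLinearTrajectory.continuousOn {I : E × U →L[ℝ] E} {N : ℕ} {τ : ℕ → ℝ} {σ : ℝ → E}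
    {u : ℕ → ℝ → U} (h : IsLinearTrajectory I N τ σ u) {l : ℕ} (hl : l < N) :
    ContinuousOn (fun t => (σ t, u l t)) (Icc (τ l) (τ (l + 1))) :=
  ContinuousOn.prodMk (fun t ht => ((h l hl).2 t ht).continuousWithinAt) (h l hl).1

variable {ι : Type*} [Fintype ι]

/-- Integration by parts against a solution of the closed-loop adjoint equation. -/
theorem sum_integral_running_eq {I : E × U →L[ℝ] E} {N : ℕ} {τ : ℕ → ℝ}
    (hτ : ∀ l < N, τ l < τ (l + 1)) {ψ : ℕ → ℝ → (E × U) →L[ℝ] ℝ}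
    (hψ : ∀ l < N, ContinuousOn (ψ l) (Icc (τ l) (τ (l + 1)))) {K : ℕ → ℝ → E →L[ℝ] U}
    {lam : ℝ → E →L[ℝ] ℝ}
    (hlam : ∀ l < N, ∀ t ∈ Icc (τ l) (τ (l + 1)), HasDerivWithinAt lam
      (-((lam t).comp I + ψ l t).comp ((ContinuousLinearMap.id ℝ E).prod (K l t)))
      (Icc (τ l) (τ (l + 1))) t)
    {σ : ℝ → E} {w : ℕ → ℝ → U} (hw : ∀ l < N, ContinuousOn (w l) (Icc (τ l) (τ (l + 1))))
    (hσ : IsLinearTrajectory I N τ σ (fun l t => K l t (σ t) + w l t)) :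
    ∑ l ∈ Finset.range N, ∫ t in (τ l)..(τ (l + 1)), ψ l t (σ t, K l t (σ t) + w l t) =
      (∑ l ∈ Finset.range N, ∫ t in (τ l)..(τ (l + 1)), ((lam t).comp I + ψ l t) (0, w l t)) -
        (lam (τ N) (σ (τ N)) - lam (τ 0) (σ (τ 0))) := by
  rw [← Finset.sum_range_sub (fun l => lam (τ l) (σ (τ l))), ← Finset.sum_sub_distrib]
  refine Finset.sum_congr rfl fun l hl => ?_
  replace hl := Finset.mem_range.1 hl
  have hle := (hτ l hl).le
  have hlamc : ContinuousOn lam (Icc (τ l) (τ (l + 1))) := fun t ht =>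
    (hlam l hl t ht).continuousWithinAt
  have hc1 : ContinuousOn (fun t => ψ l t (σ t, K l t (σ t) + w l t)) (Icc (τ l) (τ (l + 1))) :=
    (hψ l hl).clm_apply (hσ.continuousOn hl)
  have hc2 : ContinuousOn (fun t => ((lam t).comp I + ψ l t) (0, w l t))
      (Icc (τ l) (τ (l + 1))) :=
    ((hlamc.clm_comp continuousOn_const).add (hψ l hl)).clm_apply
      (continuousOn_const.prodMk (hw l hl))
  have hi1 := hc1.intervalIntegrable_of_Icc (μ := MeasureTheory.volume) hle
  have hi2 := hc2.intervalIntegrable_of_Icc (μ := MeasureTheory.volume) hle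
  -- The integrand is the derivative of `lam t (σ t)`: by the adjoint equation the costate terms at
  -- `(σ, K σ)` cancel.
  have key : ∫ t in (τ l)..(τ (l + 1)), (((lam t).comp I + ψ l t) (0, w l t) -
      ψ l t (σ t, K l t (σ t) + w l t)) = lam (τ (l + 1)) (σ (τ (l + 1))) - lam (τ l) (σ (τ l)) := by
    refine intervalIntegral.integral_eq_sub_of_hasDerivAt_of_le (f := fun t => lam t (σ t)) hle
      (hlamc.clm_apply fun t ht => ((hσ l hl).2 t ht).continuousWithinAt) ?_ (hi2.sub hi1)
    intro t ht
    have hn : Icc (τ l) (τ (l + 1)) ∈ 𝓝 t := Icc_mem_nhds ht.1 ht.2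
    have h1 := ((hlam l hl t (Ioo_subset_Icc_self ht)).hasDerivAt hn).clm_apply
      (((hσ l hl).2 t (Ioo_subset_Icc_self ht)).hasDerivAt hn)
    refine h1.congr_deriv ?_
    have h2 : ((σ t, K l t (σ t) + w l t) : E × U) = (σ t, K l t (σ t)) + (0, w l t) := by simp
    rw [h2]
    simp only [map_add, ContinuousLinearMap.comp_apply, _root_.neg_apply, _root_.add_apply,
      ContinuousLinearMap.prod_apply, ContinuousLinearMap.id_apply]
    ring
  rw [intervalIntegral.integral_sub hi2 hi1] at key
  linarith

set_option maxHeartbeats 1000000 in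
/-- Multipliers of a linear control problem with cone constraints: if the linear functional
`β₀ σ(τ 0) + βf (σ, u)(τ N) + ∑ ∫ ψ (σ, u)` is nonnegative on all trajectories along which the
active forms are negative, then it has an adjoint arc and nonnegative multipliers. -/
theorem exists_adjoint_of_nonneg [CompleteSpace E] (I : E × U →L[ℝ] E) {N : ℕ} (hN : 0 < N)
    {τ : ℕ → ℝ} (hτ : ∀ l < N, τ l < τ (l + 1)) {γ : ℕ → ℝ → ι → (E × U) →L[ℝ] ℝ}
    (hγ : ∀ l < N, ∀ j, ContinuousOn (fun t => γ l t j) (Icc (τ l) (τ (l + 1))))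
    {A : ℕ → ℝ → Set ι}
    (hA : ∀ l < N, ∀ t ∈ Icc (τ l) (τ (l + 1)),
      ∀ᶠ s in 𝓝[Icc (τ l) (τ (l + 1))] t, A l s ⊆ A l t)
    (hind : ∀ l < N, ∀ t ∈ Icc (τ l) (τ (l + 1)), LinearIndependent ℝ
      (fun j : A l t => (γ l t j).comp (ContinuousLinearMap.inr ℝ E U)))
    {ψ : ℕ → ℝ → (E × U) →L[ℝ] ℝ}
    (hψ : ∀ l < N, ContinuousOn (ψ l) (Icc (τ l) (τ (l + 1))))
    (β₀ : E →L[ℝ] ℝ) (βf : E × U →L[ℝ] ℝ)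
    (hL : ∀ σ u, IsLinearTrajectory I N τ σ u →
      (∀ l < N, ∀ t ∈ Icc (τ l) (τ (l + 1)), ∀ j ∈ A l t, γ l t j (σ t, u l t) < 0) →
      0 ≤ β₀ (σ (τ 0)) + βf (σ (τ N), u (N - 1) (τ N)) +
        ∑ l ∈ Finset.range N, ∫ t in (τ l)..(τ (l + 1)), ψ l t (σ t, u l t)) :
    ∃ (lam : ℝ → E →L[ℝ] ℝ) (μ : ℕ → ℝ → ι → ℝ),
      ContinuousOn lam (Icc (τ 0) (τ N)) ∧ lam (τ 0) = -β₀ ∧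
      (∀ l < N, ∀ t ∈ Ioo (τ l) (τ (l + 1)),
        (∀ j, 0 ≤ μ l t j) ∧ (∀ j, j ∉ A l t → μ l t j = 0) ∧
        ((lam t).comp I + ψ l t + ∑ j, μ l t j • γ l t j).comp
          (ContinuousLinearMap.inr ℝ E U) = 0 ∧
        HasDerivAt lam (-((lam t).comp I + ψ l t + ∑ j, μ l t j • γ l t j).comp
          (ContinuousLinearMap.inl ℝ E U)) t) ∧
      (βf.comp (ContinuousLinearMap.inr ℝ E U) = 0 →
        lam (τ N) = βf.comp (ContinuousLinearMap.inl ℝ E U)) := by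
  classical
  have hfb : ∀ l, ∃ K : ℝ → E →L[ℝ] U, l < N → Continuous K ∧
      ∀ t ∈ Icc (τ l) (τ (l + 1)), ∀ j ∈ A l t, ∀ d, γ l t j (d, K t d) = 0 := fun l => by
    by_cases hl : l < N
    · obtain ⟨K, hK⟩ := exists_annihilating_feedback (hτ l hl).le (hγ l hl) (hA l hl) (hind l hl)
      exact ⟨K, fun _ => hK⟩
    · exact ⟨0, fun h => absurd h hl⟩
  choose K hK using hfb
  have hsc : ∀ l, ∃ w : ℝ → U, l < N → Continuous w ∧
      ∀ t ∈ Icc (τ l) (τ (l + 1)), ∀ j ∈ A l t, γ l t j (0, w t) < 0 := fun l => by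
    by_cases hl : l < N
    · obtain ⟨w, hw⟩ := exists_strict_control (hτ l hl).le
        (γ := fun t j => (γ l t j).comp (ContinuousLinearMap.inr ℝ E U))
        (fun j => (hγ l hl j).clm_comp continuousOn_const) (hA l hl) (hind l hl)
      exact ⟨w, fun _ => ⟨hw.1, fun t ht j hj => by simpa using hw.2 t ht j hj⟩⟩
    · exact ⟨0, fun h => absurd h hl⟩
  choose w₁ hw₁ using hsc
  let D : ℕ → ℝ → E →L[ℝ] E × U := fun l t => (ContinuousLinearMap.id ℝ E).prod (K l t)
  have hD : ∀ l < N, ContinuousOn (D l) (Icc (τ l) (τ (l + 1))) := fun l hl =>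
    ((ContinuousLinearMap.prodₗᵢ ℝ).continuous.comp
      (continuous_const.prodMk (hK l hl).1)).continuousOn
  -- The closed-loop adjoint equation contains no `μ`, so it can be solved before multipliers are
  -- known. As `βf` also sees the control, the final value is `βf` along the feedback.
  obtain ⟨lam, hlamN, hlam⟩ := exists_backward_piecewise_solution hτ
    (M := fun l t => -(ContinuousLinearMap.compL ℝ E E ℝ).flip (I.comp (D l t)))
    (f := fun l t => -(ψ l t).comp (D l t))
    (fun l hl => (((ContinuousLinearMap.compL ℝ E E ℝ).flip.continuous.comp_continuousOn
      (continuousOn_const.clm_comp (hD l hl))).neg))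
    (fun l hl => ((hψ l hl).clm_comp (hD l hl)).neg) (βf.comp (D (N - 1) (τ N)))
  replace hlam : ∀ l < N, ∀ t ∈ Icc (τ l) (τ (l + 1)), HasDerivWithinAt lam
      (-((lam t).comp I + ψ l t).comp (D l t)) (Icc (τ l) (τ (l + 1))) t := by
    intro l hl t ht
    refine (hlam l hl t ht).congr_deriv ?_
    ext d
    simp [add_comm]
  have hlamc : ∀ l < N, ContinuousOn lam (Icc (τ l) (τ (l + 1))) := fun l hl t ht =>
    (hlam l hl t ht).continuousWithinAt
  have hhc : ∀ l < N, ContinuousOn (fun t => (lam t).comp I + ψ l t) (Icc (τ l) (τ (l + 1))) :=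
    fun l hl => ((hlamc l hl).clm_comp continuousOn_const).add (hψ l hl)
  -- The initial state `d` and the residual control `w` are independent data, and the state has left
  -- the inequality except for `d`.
  have key : ∀ (d : E) (w : ℕ → ℝ → U),
      (∀ l < N, ContinuousOn (w l) (Icc (τ l) (τ (l + 1)))) →
      (∀ l < N, ∀ t ∈ Icc (τ l) (τ (l + 1)), ∀ j ∈ A l t, γ l t j (0, w l t) < 0) →
      0 ≤ (β₀ + lam (τ 0)) d + βf (0, w (N - 1) (τ N)) + ∑ l ∈ Finset.range N,
        ∫ t in (τ l)..(τ (l + 1)), ((lam t).comp I + ψ l t) (0, w l t) := by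
    intro d w hw hneg
    obtain ⟨σ, hσ0, hσ⟩ := exists_forward_piecewise_solution hτ
      (M := fun l t => I.comp (D l t)) (f := fun l t => I (0, w l t))
      (fun l hl => continuousOn_const.clm_comp (hD l hl))
      (fun l hl => I.continuous.comp_continuousOn (continuousOn_const.prodMk (hw l hl))) d
    have hσc : ∀ l < N, ContinuousOn σ (Icc (τ l) (τ (l + 1))) := fun l hl t ht =>
      (hσ l hl t ht).continuousWithinAt
    have htraj : IsLinearTrajectory I N τ σ (fun l t => K l t (σ t) + w l t) := by
      refine fun l hl => ⟨((hK l hl).1.continuousOn.clm_apply (hσc l hl)).add (hw l hl),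
        fun t ht => ?_⟩
      refine (hσ l hl t ht).congr_deriv ?_
      have : ((σ t, K l t (σ t) + w l t) : E × U) = D l t (σ t) + (0, w l t) := by simp [D]
      rw [this, map_add]
      rfl
    have h1 := hL σ _ htraj (fun l hl t ht j hj => by
      have : ((σ t, K l t (σ t) + w l t) : E × U) = (σ t, K l t (σ t)) + (0, w l t) := by simp
      rw [this, map_add, (hK l hl).2 t ht j hj, zero_add]
      exact hneg l hl t ht j hj)
    rw [sum_integral_running_eq hτ hψ hlam hw htraj] at h1
    have h2 : ((σ (τ N), K (N - 1) (τ N) (σ (τ N)) + w (N - 1) (τ N)) : E × U) =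
      D (N - 1) (τ N) (σ (τ N)) + (0, w (N - 1) (τ N)) := by simp [D]
    have h3 : lam (τ N) (σ (τ N)) = βf (D (N - 1) (τ N) (σ (τ N))) := by rw [hlamN]; rfl
    rw [h2, map_add, h3, hσ0] at h1
    rw [_root_.add_apply]
    linarith
  have hw₁c : ∀ l < N, ContinuousOn (w₁ l) (Icc (τ l) (τ (l + 1))) := fun l hl =>
    (hw₁ l hl).1.continuousOn
  have hinit : lam (τ 0) = -β₀ := by
    rw [eq_neg_iff_add_eq_zero, add_comm]
    ext d
    refine eq_zero_of_forall_mul_add_nonneg (c := βf (0, w₁ (N - 1) (τ N)) +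
      ∑ l ∈ Finset.range N,
        ∫ t in (τ l)..(τ (l + 1)), ((lam t).comp I + ψ l t) (0, w₁ l t)) fun M => ?_
    have := key (M • d) w₁ hw₁c (fun l hl => (hw₁ l hl).2)
    rw [map_smul, smul_eq_mul, add_assoc] at this
    exact this
  have hstrict : ∀ l < N, ∀ t ∈ Ioo (τ l) (τ (l + 1)), ∀ v : U,
      (∀ j ∈ A l t, γ l t j (0, v) < 0) → 0 ≤ ((lam t).comp I + ψ l t) (0, v) := by
    intro l hl t ht v hv
    by_contra! hcon
    have htc := Ioo_subset_Icc_self ht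
    have e1 : ∀ᶠ s in 𝓝 t, ((lam s).comp I + ψ l s) (0, v) < 0 := by
      have := ((hhc l hl).clm_apply continuousOn_const t htc).eventually (gt_mem_nhds hcon)
      rwa [nhdsWithin_eq_nhds.2 (Icc_mem_nhds ht.1 ht.2)] at this
    have e2 : ∀ᶠ s in 𝓝 t, ∀ j ∈ A l s, γ l s j (0, v) < 0 := by
      have h1 : ∀ᶠ s in 𝓝 t, ∀ j ∈ A l t, γ l s j (0, v) < 0 := by
        refine eventually_all.2 fun j => ?_
        by_cases hj : j ∈ A l t
        · have := ((hγ l hl j).clm_apply continuousOn_const t htc).eventually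
            (gt_mem_nhds (hv j hj))
          rw [nhdsWithin_eq_nhds.2 (Icc_mem_nhds ht.1 ht.2)] at this
          exact this.mono fun s hs _ => hs
        · exact Eventually.of_forall fun s h => absurd h hj
      have h2 := hA l hl t htc
      rw [nhdsWithin_eq_nhds.2 (Icc_mem_nhds ht.1 ht.2)] at h2
      filter_upwards [h1, h2] with s h1 h2 j hj using h1 j (h2 hj)
    obtain ⟨ε, hε, hball⟩ := Metric.eventually_nhds_iff_ball.1
      ((e1.and e2).and (Ioo_mem_nhds ht.1 ht.2))
    -- A tent supported in the ball. Adding `M φ v` to `w₁` keeps the active forms negative for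
    -- every `M ≥ 0`, while the integral would tend to `-∞`. The ball lies in the open arc, so the
    -- control at `τ N` is unchanged.
    let φ : ℝ → ℝ := fun s => max 0 (ε - dist s t)
    have hφc : Continuous φ := by fun_prop
    have hφ0 : ∀ s, 0 ≤ φ s := fun s => le_max_left _ _
    have hφz : ∀ s, s ∉ Metric.ball t ε → φ s = 0 := fun s hs =>
      max_eq_left (by rw [Metric.mem_ball, not_lt] at hs; linarith)
    let f : ℝ → ℝ := fun s => ((lam s).comp I + ψ l s) (0, φ s • v)
    have hf : ∀ s, f s = φ s * ((lam s).comp I + ψ l s) (0, v) := fun s => by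
      have : ((0, φ s • v) : E × U) = φ s • (0, v) := by simp
      simp only [f]
      rw [this, map_smul, smul_eq_mul]
    have hfc : ContinuousOn f (Icc (τ l) (τ (l + 1))) := (hhc l hl).clm_apply
      (continuousOn_const.prodMk (hφc.continuousOn.smul continuousOn_const))
    have hneg : 0 < ∫ s in (τ l)..(τ (l + 1)), -f s := by
      refine intervalIntegral.integral_pos (hτ l hl) hfc.neg (fun s _ => ?_) ⟨t, htc, ?_⟩
      · rw [Left.nonneg_neg_iff, hf]
        by_cases hs : s ∈ Metric.ball t ε
        · exact mul_nonpos_of_nonneg_of_nonpos (hφ0 s) (hball s hs).1.1.le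
        · rw [hφz s hs, zero_mul]
      · rw [hf]
        have : φ t = ε := by simp [φ, hε.le]
        rw [this]
        nlinarith
    rw [intervalIntegral.integral_neg] at hneg
    refine absurd (nonneg_of_forall_mul_add_nonneg (x := ∫ s in (τ l)..(τ (l + 1)), f s)
      (c := βf (0, w₁ (N - 1) (τ N)) + ∑ l ∈ Finset.range N,
        ∫ t in (τ l)..(τ (l + 1)), ((lam t).comp I + ψ l t) (0, w₁ l t)) fun M hM => ?_)
      (by linarith)
    let w : ℕ → ℝ → U := fun l' s => w₁ l' s + if l' = l then M • φ s • v else 0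
    have hwc : ∀ l' < N, ContinuousOn (w l') (Icc (τ l') (τ (l' + 1))) := by
      intro l' hl'
      refine (hw₁c l' hl').add ?_
      split_ifs
      · exact (continuous_const.smul (hφc.smul continuous_const)).continuousOn
      · exact continuousOn_const
    have h1 := key 0 w hwc (by
      intro l' hl' s hs j hj
      have h0 := (hw₁ l' hl').2 s hs j hj
      simp only [w]
      split_ifs with heq
      · subst heq
        have : ((0, w₁ l' s + M • φ s • v) : E × U) = (0, w₁ l' s) + (M * φ s) • (0, v) := by
          simp [mul_smul]
        rw [this, map_add, map_smul, smul_eq_mul]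
        by_cases hs' : s ∈ Metric.ball t ε
        · have h2 := (hball s hs').1.2 j hj
          have h3 := mul_nonneg hM (hφ0 s)
          nlinarith
        · rw [hφz s hs', mul_zero, zero_mul, add_zero]
          exact h0
      · rw [add_zero]
        exact h0)
    have h2 : w (N - 1) (τ N) = w₁ (N - 1) (τ N) := by
      simp only [w]
      split_ifs with heq
      · have : τ N ∉ Metric.ball t ε := fun hmem => by
          have := (hball _ hmem).2.2
          rw [← heq, Nat.sub_add_cancel hN] at this
          exact lt_irrefl _ this
        rw [hφz _ this]
        simp
      · rw [add_zero]
    have h3 : ∑ l' ∈ Finset.range N, ∫ s in (τ l')..(τ (l' + 1)),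
        ((lam s).comp I + ψ l' s) (0, w l' s) =
        (∑ l' ∈ Finset.range N, ∫ s in (τ l')..(τ (l' + 1)),
          ((lam s).comp I + ψ l' s) (0, w₁ l' s)) +
        ∑ l' ∈ Finset.range N, if l' = l then M * ∫ s in (τ l)..(τ (l + 1)), f s else 0 := by
      rw [← Finset.sum_add_distrib]
      refine Finset.sum_congr rfl fun l' hl' => ?_
      replace hl' := Finset.mem_range.1 hl'
      simp only [w]
      split_ifs with heq
      · subst heq
        rw [← intervalIntegral.integral_const_mul, ← intervalIntegral.integral_add]
        · congr 1
          ext s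
          have : ((0, w₁ l' s + M • φ s • v) : E × U) = (0, w₁ l' s) + M • (0, φ s • v) := by
            simp
          rw [this, map_add, map_smul, smul_eq_mul]
        · have := (hhc l' hl').clm_apply 
            ((continuousOn_const (c := (0 : E))).prodMk (hw₁c l' hl'))
          exact this.intervalIntegrable_of_Icc (hτ l' hl').le
        · exact (continuousOn_const.mul hfc).intervalIntegrable_of_Icc (hτ l' hl').le
      · simp
    rw [h2, h3, Finset.sum_ite_eq', if_pos (Finset.mem_range.2 hl), map_zero, zero_add] at h1
    linarith
  have hpos : ∀ l < N, ∀ t ∈ Ioo (τ l) (τ (l + 1)), ∀ v : U,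
      (∀ j ∈ A l t, γ l t j (0, v) ≤ 0) → 0 ≤ ((lam t).comp I + ψ l t) (0, v) := by
    intro l hl t ht v hv
    -- Adding `κ w₁` moves the closed cone into the open one; then `κ → 0`.
    refine nonneg_of_forall_pos_add_mul_nonneg (c := ((lam t).comp I + ψ l t) (0, w₁ l t))
      fun κ hκ => ?_
    have hsum : ((0, v + κ • w₁ l t) : E × U) = (0, v) + κ • (0, w₁ l t) := by simp
    have := hstrict l hl t ht (v + κ • w₁ l t) fun j hj => by
      rw [hsum, map_add, map_smul, smul_eq_mul]
      have h1 := hv j hj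
      have h2 := (hw₁ l hl).2 t (Ioo_subset_Icc_self ht) j hj
      nlinarith
    rwa [hsum, map_add, map_smul, smul_eq_mul] at this
  have hmu : ∀ l t, ∃ μ : ι → ℝ, l < N → t ∈ Ioo (τ l) (τ (l + 1)) → (∀ j, 0 ≤ μ j) ∧
      (∀ j, j ∉ A l t → μ j = 0) ∧
      ((lam t).comp I + ψ l t).comp (ContinuousLinearMap.inr ℝ E U) +
        ∑ j, μ j • (γ l t j).comp (ContinuousLinearMap.inr ℝ E U) = 0 := by
    intro l t
    by_cases h : l < N ∧ t ∈ Ioo (τ l) (τ (l + 1))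
    · obtain ⟨μ, hμ⟩ := exists_nonneg_multiplier
        (fun j => (γ l t j).comp (ContinuousLinearMap.inr ℝ E U)) (A l t)
        (hind l h.1 t (Ioo_subset_Icc_self h.2))
        (((lam t).comp I + ψ l t).comp (ContinuousLinearMap.inr ℝ E U))
        (fun v hv => hpos l h.1 t h.2 v hv)
      exact ⟨μ, fun _ _ => hμ⟩
    · exact ⟨0, fun h1 h2 => absurd ⟨h1, h2⟩ h⟩
  choose μ hμ using hmu
  refine ⟨lam, μ, continuousOn_Icc_of_arcs hτ hN hlamc, hinit, fun l hl t ht => ?_, fun h0 => ?_⟩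
  · obtain ⟨h1, h2, h3⟩ := hμ l t hl ht
    have htc := Ioo_subset_Icc_self ht
    refine ⟨h1, h2, ?_, ?_⟩
    · rw [← h3]
      ext v
      simp
    · refine ((hlam l hl t htc).hasDerivAt (Icc_mem_nhds ht.1 ht.2)).congr_deriv ?_
      ext d
      have h4 := DFunLike.congr_fun h3 (K l t d)
      -- The active forms vanish on `(d, K d)`, so `(d, 0)` can be traded for `-(0, K d)`. Together
      -- with stationarity this identifies the closed-loop equation with the adjoint equation that
      -- contains `μ`.
      have h5 : ∀ j, μ l t j * γ l t j (d, 0) = -(μ l t j * γ l t j (0, K l t d)) := by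
        intro j
        by_cases hj : j ∈ A l t
        · have h6 := (hK l hl).2 t htc j hj d
          have h7 : ((d, K l t d) : E × U) = (d, 0) + (0, K l t d) := by simp
          rw [h7, map_add] at h6
          linear_combination μ l t j * h6
        · rw [h2 j hj]
          ring
      have h8 : D l t d = (d, 0) + (0, K l t d) := by simp [D]
      simp only [_root_.add_apply, ContinuousLinearMap.comp_apply, sum_apply, smul_apply,
        smul_eq_mul, ContinuousLinearMap.inr_apply, _root_.zero_apply] at h4
      simp only [_root_.neg_apply, _root_.add_apply, ContinuousLinearMap.comp_apply, sum_apply,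
        smul_apply, smul_eq_mul, ContinuousLinearMap.inl_apply, h8, map_add, h5,
        Finset.sum_neg_distrib]
      linarith
  · rw [hlamN]
    ext d
    have h1 : D (N - 1) (τ N) d = (d, 0) + (0, K (N - 1) (τ N) d) := by simp [D]
    have h2 := DFunLike.congr_fun h0 (K (N - 1) (τ N) d)
    simp only [ContinuousLinearMap.comp_apply, ContinuousLinearMap.inr_apply,
      _root_.zero_apply] at h2
    rw [ContinuousLinearMap.comp_apply, ContinuousLinearMap.comp_apply, h1, map_add, h2, add_zero]
    rfl

end Core

/-! ### Separation and Fritz John multipliers in finite dimension. -/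

/-- No interior is needed: a nonempty convex set without interior lies in a proper affine subspace,
on which some nonzero functional is constant, and its sign can be chosen. -/
theorem exists_nonneg_functional_of_zero_notMem {X : Type*} [NormedAddCommGroup X]
    [NormedSpace ℝ X] [FiniteDimensional ℝ X] {S : Set X} (hS : Convex ℝ S) (h0 : (0 : X) ∉ S) :
    S = ∅ ∨ ∃ f : X →L[ℝ] ℝ, f ≠ 0 ∧ ∀ x ∈ S, 0 ≤ f x := by
  rcases S.eq_empty_or_nonempty with rfl | ⟨x₀, hx₀⟩
  · exact Or.inl rfl
  right
  by_cases hint : (interior S).Nonempty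
  · obtain ⟨f, hf, hle⟩ := geometric_hahn_banach_of_nonempty_interior_point hS
      (fun h => h0 (interior_subset h) : (0 : X) ∉ interior S) hint
    exact ⟨-f, neg_ne_zero.2 hf, fun x hx => by simpa using hle x hx⟩
  · rw [hS.interior_nonempty_iff_affineSpan_eq_top] at hint
    have hdir : (affineSpan ℝ S).direction ≠ ⊤ := fun h => hint
      ((AffineSubspace.direction_eq_top_iff_of_nonempty ⟨x₀, subset_affineSpan ℝ S hx₀⟩).1 h)
    obtain ⟨φ, hφ, hle⟩ := Submodule.exists_le_ker_of_lt_top _ (lt_top_iff_ne_top.2 hdir)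
    have hconst : ∀ x ∈ S, φ x = φ x₀ := fun x hx => by
      have : φ (x -ᵥ x₀) = 0 := hle (AffineSubspace.vsub_mem_direction
        (subset_affineSpan ℝ S hx) (subset_affineSpan ℝ S hx₀))
      rwa [vsub_eq_sub, map_sub, sub_eq_zero] at this
    have hφ' : LinearMap.toContinuousLinearMap φ ≠ 0 := by simpa using hφ
    rcases le_total 0 (φ x₀) with h | h
    · exact ⟨LinearMap.toContinuousLinearMap φ, hφ', fun x hx => by simpa [hconst x hx] using h⟩
    · exact ⟨-LinearMap.toContinuousLinearMap φ, neg_ne_zero.2 hφ',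
        fun x hx => by simpa [hconst x hx] using h⟩

/-- Fritz John multipliers for a linear functional on a convex cone under finitely many linear
equations. -/
theorem exists_fritzJohn_multipliers {V : Type*} [AddCommGroup V] [Module ℝ V] {β : Type*}
    [Fintype β] (T : V →ₗ[ℝ] β → ℝ) (J : V →ₗ[ℝ] ℝ) {C : Set V} (hC : Convex ℝ C)
    (h : Function.Surjective T → ∀ x ∈ C, T x = 0 → 0 ≤ J x) :
    ∃ (ν : β → ℝ) (lam₀ : ℝ), 0 ≤ lam₀ ∧ (ν ≠ 0 ∨ lam₀ ≠ 0) ∧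
      ∀ x ∈ C, 0 ≤ ∑ e, ν e * T x e + lam₀ * J x := by
  classical
  have hrep : ∀ φ : (β → ℝ) →ₗ[ℝ] ℝ, ∀ y, φ y = ∑ e, φ (Pi.single e 1) * y e := fun φ y => by
    rw [LinearMap.pi_apply_eq_sum_univ φ y]
    refine Finset.sum_congr rfl fun e _ => ?_
    rw [smul_eq_mul, mul_comm]
    congr 2
    ext i
    simp [Pi.single_apply, eq_comm]
  by_cases hT : Function.Surjective T
  · let S : Set ((β → ℝ) × ℝ) := {y | ∃ x ∈ C, T x = y.1 ∧ J x < y.2}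
    have hS : Convex ℝ S := by
      rintro y ⟨x, hx, h1, h2⟩ y' ⟨x', hx', h1', h2'⟩ p q hp hq hpq
      refine ⟨p • x + q • x', hC hx hx' hp hq hpq, by simp [h1, h1'], ?_⟩
      simp only [map_add, map_smul, smul_eq_mul, Prod.snd_add, Prod.smul_snd]
      rcases hp.eq_or_lt with rfl | hp'
      · rw [zero_add] at hpq
        subst hpq
        simpa using h2'
      · nlinarith
    have h0 : (0 : (β → ℝ) × ℝ) ∉ S := by
      rintro ⟨x, hx, h1, h2⟩
      exact absurd (h hT x hx h1) (not_le.2 h2)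
    rcases exists_nonneg_functional_of_zero_notMem hS h0 with hemp | ⟨f, hf, hfS⟩
    · refine ⟨0, 1, zero_le_one, Or.inr one_ne_zero, fun x hx => ?_⟩
      have : (T x, J x + 1) ∈ S := ⟨x, hx, rfl, by simp⟩
      rw [hemp] at this
      exact absurd this (notMem_empty _)
    · by_cases hCe : C = ∅
      · refine ⟨0, 1, zero_le_one, Or.inr one_ne_zero, fun x hx => ?_⟩
        rw [hCe] at hx
        exact absurd hx (notMem_empty _)
      let ν : β → ℝ := fun e => f (Pi.single e 1, 0)
      let lam₀ : ℝ := f (0, 1)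
      have hfx : ∀ y r, f (y, r) = ∑ e, ν e * y e + lam₀ * r := fun y r => by
        have h1 : ((y, r) : (β → ℝ) × ℝ) = (y, 0) + r • (0, 1) := by simp
        rw [h1, map_add, map_smul, smul_eq_mul, mul_comm r]
        congr 1
        exact hrep (f.toLinearMap ∘ₗ LinearMap.inl ℝ (β → ℝ) ℝ) y
      have hS' : ∀ x ∈ C, ∀ r : ℝ, 0 < r → 0 ≤ (∑ e, ν e * T x e + lam₀ * J x) + r * lam₀ := by
        intro x hx r hr
        have := hfS (T x, J x + r) ⟨x, hx, rfl, by simpa using hr⟩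
        rw [hfx] at this
        linarith
      refine ⟨ν, lam₀, ?_, ?_, fun x hx => nonneg_of_forall_pos_add_mul_nonneg (hS' x hx)⟩
      · obtain ⟨x, hx⟩ := nonempty_iff_ne_empty.2 hCe
        refine nonneg_of_forall_mul_add_nonneg
          (c := (∑ e, ν e * T x e + lam₀ * J x) + lam₀) fun M hM => ?_
        have := hS' x hx (M + 1) (by linarith)
        linarith
      · by_contra! hcon
        refine hf (ContinuousLinearMap.ext fun y => ?_)
        rw [← Prod.mk.eta (p := y), hfx, hcon.1, hcon.2]
        simp
  -- If `T` is not onto, a nonzero functional vanishing on its range serves, with `lam₀ = 0`.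
  · have hlt : LinearMap.range T < ⊤ :=
      lt_top_iff_ne_top.2 fun h' => hT (LinearMap.range_eq_top.1 h')
    obtain ⟨φ, hφ, hle⟩ := Submodule.exists_le_ker_of_lt_top _ hlt
    refine ⟨fun e => φ (Pi.single e 1), 0, le_rfl, Or.inl fun h' => hφ ?_, fun x _ => ?_⟩
    · refine LinearMap.pi_ext' fun e => LinearMap.ext_ring ?_
      simpa using congrFun h' e
    · have : φ (T x) = 0 := hle ⟨x, rfl⟩
      rw [← hrep φ, this]
      simp

/-! ### First-order estimates for perturbations, uniform in time. -/

/-- Solutions of `β = 0` along a direction that is tangent to its zero set. -/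
theorem exists_curve_in_zero_set {Y W : Type*} [NormedAddCommGroup Y] [NormedSpace ℝ Y]
    [NormedAddCommGroup W] [NormedSpace ℝ W] [CompleteSpace W] {β : Y → W} {β' : Y →L[ℝ] W}
    {y₀ : Y} (hβ : HasStrictFDerivAt β β' y₀) (h0 : β y₀ = 0) {d : Y} {D : W →L[ℝ] Y}
    (hd : β' d = 0) (hD : ∀ w, β' (D w) = w) :
    ∃ c : ℝ → W, Tendsto c (𝓝[>] 0) (𝓝 0) ∧
      ∀ᶠ ε in 𝓝[>] (0 : ℝ), β (y₀ + ε • (d + D (c ε))) = 0 := by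
  -- The map `(ε, w) ↦ (ε, β (y₀ + ε d + D w))` has derivative the identity at `0`, by tangency of
  -- `d`. Its local inverse gives `w(ε) = o(ε)`, and `c = w / ε`.
  let L : ℝ × W →L[ℝ] Y := (ContinuousLinearMap.toSpanSingleton ℝ d).coprod D
  let Φ : ℝ × W → ℝ × W := fun x => (x.1, β (y₀ + L x))
  have hΦ : HasStrictFDerivAt Φ ((ContinuousLinearEquiv.refl ℝ (ℝ × W) : (ℝ × W) ≃L[ℝ] ℝ × W) :
      ℝ × W →L[ℝ] ℝ × W) 0 := by
    have h1 : HasStrictFDerivAt (fun x => y₀ + L x) L 0 := L.hasStrictFDerivAt.const_add y₀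
    have h2 : HasStrictFDerivAt β β' (y₀ + L 0) := by simpa using hβ
    have h3 := (hasStrictFDerivAt_fst (𝕜 := ℝ) (p := (0 : ℝ × W))).prodMk (h2.comp 0 h1)
    refine h3.congr_fderiv ?_
    ext x <;> simp [L, hd, hD]
  have hΦ0 : Φ 0 = 0 := by simp [Φ, h0]
  have hg := hΦ.to_localInverse
  have hg0 := hΦ.localInverse_apply_image
  have hr := hΦ.eventually_right_inverse
  rw [hΦ0] at hg hg0 hr
  set g := hΦ.localInverse Φ _ 0 with hgdef
  let ι : ℝ → ℝ × W := fun ε => (ε, 0)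
  have hι : Tendsto ι (𝓝 0) (𝓝 0) := by
    have : Continuous ι := by fun_prop
    exact this.tendsto' 0 0 rfl
  have hder : HasDerivAt (fun ε => (g (ι ε)).2) 0 0 := by
    have h1 : HasDerivAt ι (1, 0) 0 := (hasDerivAt_id (0 : ℝ)).prodMk (hasDerivAt_const 0 (0 : W))
    have h2 : HasFDerivAt g ((ContinuousLinearEquiv.refl ℝ (ℝ × W)).symm : ℝ × W →L[ℝ] ℝ × W)
      (ι 0) := hg.hasFDerivAt
    have h3 := h2.comp_hasDerivAt 0 h1
    have h4 := (hasFDerivAt_snd (𝕜 := ℝ) (p := g (ι 0))).comp_hasDerivAt 0 h3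
    exact h4.congr_deriv (by simp)
  have hslope := (hasDerivAt_iff_tendsto_slope.1 hder).mono_left
    (nhdsWithin_mono 0 fun x (hx : 0 < x) => hx.ne')
  refine ⟨fun ε => ε⁻¹ • (g (ι ε)).2, ?_, ?_⟩
  · refine hslope.congr fun ε => ?_
    have : g (ι 0) = 0 := hg0
    simp [slope_def_module, this]
  · have := (hι.eventually hr).filter_mono (nhdsWithin_le_nhds (s := Ioi 0))
    filter_upwards [this, self_mem_nhdsWithin] with ε h1 (hε : 0 < ε)
    have h2 : (g (ι ε)).1 = ε := congrArg Prod.fst h1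
    have h3 : β (y₀ + L (g (ι ε))) = 0 := congrArg Prod.snd h1
    convert h3 using 3
    rw [← Prod.mk.eta (p := g (ι ε)), h2]
    simp [L, smul_add, smul_smul, hε.ne']

/-- Strict differentiability at `y t₀` gives the estimate near `t₀`, and compactness makes it
uniform. The direction depends on a parameter near `0` to make room for the correction of the
boundary values. -/
theorem eventually_first_order_estimate {T Y W : Type*} [TopologicalSpace T] [CompactSpace T]
    [NormedAddCommGroup Y] [NormedSpace ℝ Y] [NormedAddCommGroup W] {f : Y → ℝ} {y : T → Y}
    (hy : Continuous y) (hf : ∀ t, ContDiffAt ℝ 1 f (y t)) {v : W → T → Y}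
    (hv : Continuous fun x : W × T => v x.1 x.2) {κ : ℝ} (hκ : 0 < κ) :
    ∀ᶠ x : ℝ × W in 𝓝 0, ∀ t,
      |f (y t + x.1 • v x.2 t) - f (y t) - x.1 * fderiv ℝ f (y t) (v 0 t)| ≤ κ * |x.1| := by
  have h := isCompact_univ.eventually_forall_of_forall_eventually (x₀ := (0 : ℝ × W))
    (P := fun x (t : T) =>
      |f (y t + x.1 • v x.2 t) - f (y t) - x.1 * fderiv ℝ f (y t) (v 0 t)| ≤ κ * |x.1|) ?_
  · exact h.mono fun x hx t => hx t (mem_univ t)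
  intro t₀ _
  set f₀ := fderiv ℝ f (y t₀) with hf₀
  have hstrict : HasStrictFDerivAt f f₀ (y t₀) := (hf t₀).hasStrictFDerivAt one_ne_zero
  set B : ℝ := ‖v 0 t₀‖ + 1 with hB
  have hB0 : 0 < B := by positivity
  have hvc : Continuous fun p : (ℝ × W) × T => v p.1.2 p.2 :=
    hv.comp ((continuous_snd.comp continuous_fst).prodMk continuous_snd)
  have hv0 : Continuous fun p : (ℝ × W) × T => v 0 p.2 :=
    hv.comp (continuous_const.prodMk continuous_snd)
  have hyc : Continuous fun p : (ℝ × W) × T => y p.2 := hy.comp continuous_snd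
  have e1 : ∀ᶠ p : (ℝ × W) × T in 𝓝 (0, t₀),
      ‖f (y p.2 + p.1.1 • v p.1.2 p.2) - f (y p.2) - f₀ (y p.2 + p.1.1 • v p.1.2 p.2 - y p.2)‖ ≤
        κ / (2 * B) * ‖y p.2 + p.1.1 • v p.1.2 p.2 - y p.2‖ := by
    have hc : Continuous fun p : (ℝ × W) × T =>
        (y p.2 + p.1.1 • v p.1.2 p.2, y p.2) :=
      (hyc.add ((continuous_fst.comp continuous_fst).smul hvc)).prodMk hyc
    have ht := hc.tendsto' (0, t₀) (y t₀, y t₀) (by simp)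
    exact ht.eventually (hstrict.isLittleO.def (by positivity))
  have e2 : ∀ᶠ p : (ℝ × W) × T in 𝓝 (0, t₀), ‖v p.1.2 p.2‖ < B := by
    refine hvc.norm.continuousAt.eventually (gt_mem_nhds ?_)
    simp [B]
  have e3 : ∀ᶠ p : (ℝ × W) × T in 𝓝 (0, t₀),
      |f₀ (v p.1.2 p.2) - fderiv ℝ f (y p.2) (v 0 p.2)| < κ / 2 := by
    have hc : ContinuousAt (fun p : (ℝ × W) × T =>
        |f₀ (v p.1.2 p.2) - fderiv ℝ f (y p.2) (v 0 p.2)|) (0, t₀) := by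
      have h1 : ContinuousAt (fun p : (ℝ × W) × T => fderiv ℝ f (y p.2)) (0, t₀) :=
        ContinuousAt.comp (f := fun p : (ℝ × W) × T => y p.2) (g := fderiv ℝ f)
          ((hf t₀).fderiv_right (m := 0) le_rfl).continuousAt hyc.continuousAt
      exact ((f₀.continuous.comp hvc).continuousAt.sub (h1.clm_apply hv0.continuousAt)).abs
    refine hc.eventually (gt_mem_nhds ?_)
    simp [f₀, hκ]
  filter_upwards [e1, e2, e3] with p h1 h2 h3
  rw [add_sub_cancel_left, map_smul, smul_eq_mul, norm_smul, Real.norm_eq_abs,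
    Real.norm_eq_abs] at h1
  have h4 : f (y p.2 + p.1.1 • v p.1.2 p.2) - f (y p.2) -
      p.1.1 * fderiv ℝ f (y p.2) (v 0 p.2) =
      (f (y p.2 + p.1.1 • v p.1.2 p.2) - f (y p.2) - p.1.1 * f₀ (v p.1.2 p.2)) +
      p.1.1 * (f₀ (v p.1.2 p.2) - fderiv ℝ f (y p.2) (v 0 p.2)) := by ring
  rw [h4]
  refine (abs_add_le _ _).trans ?_
  rw [abs_mul]
  have h5 : κ / (2 * B) * (|p.1.1| * ‖v p.1.2 p.2‖) ≤ κ / (2 * B) * (|p.1.1| * B) := by gcongr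
  have h6 : κ / (2 * B) * (|p.1.1| * B) = κ / 2 * |p.1.1| := by field_simp
  have h7 : |p.1.1| * |f₀ (v p.1.2 p.2) - fderiv ℝ f (y p.2) (v 0 p.2)| ≤ |p.1.1| * (κ / 2) := by
    gcongr
  linarith

theorem eventually_mem_open {T Y W : Type*} [TopologicalSpace T] [CompactSpace T]
    [NormedAddCommGroup Y] [NormedSpace ℝ Y] [NormedAddCommGroup W] {Ω : Set Y} (hΩ : IsOpen Ω)
    {y : T → Y} (hy : Continuous y) (hyΩ : ∀ t, y t ∈ Ω) {v : W → T → Y}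
    (hv : Continuous fun x : W × T => v x.1 x.2) :
    ∀ᶠ x : ℝ × W in 𝓝 0, ∀ t, y t + x.1 • v x.2 t ∈ Ω := by
  have h := isCompact_univ.eventually_forall_of_forall_eventually (x₀ := (0 : ℝ × W))
    (P := fun x (t : T) => y t + x.1 • v x.2 t ∈ Ω) ?_
  · exact h.mono fun x hx t => hx t (mem_univ t)
  intro t₀ _
  have hvc : Continuous fun p : (ℝ × W) × T => v p.1.2 p.2 :=
    hv.comp ((continuous_snd.comp continuous_fst).prodMk continuous_snd)
  have hc : Continuous fun p : (ℝ × W) × T => y p.2 + p.1.1 • v p.1.2 p.2 :=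
    (hy.comp continuous_snd).add ((continuous_fst.comp continuous_fst).smul hvc)
  exact hc.continuousAt.eventually (hΩ.mem_nhds (by simpa using hyΩ t₀))

/-- Small perturbations in a direction along which the active constraint decreases stay
feasible. -/
theorem eventually_nonpos_of_strict {T Y W : Type*} [TopologicalSpace T] [CompactSpace T]
    [NormedAddCommGroup Y] [NormedSpace ℝ Y] [NormedAddCommGroup W] {f : Y → ℝ} {y : T → Y}
    (hy : Continuous y) (hf : ∀ t, ContDiffAt ℝ 1 f (y t)) {v : W → T → Y}
    (hv : Continuous fun x : W × T => v x.1 x.2) (hneg : ∀ t, f (y t) ≤ 0)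
    (hstrict : ∀ t, f (y t) = 0 → fderiv ℝ f (y t) (v 0 t) < 0) :
    ∀ᶠ x : ℝ × W in 𝓝 0, 0 < x.1 → ∀ t, f (y t + x.1 • v x.2 t) ≤ 0 := by
  rcases isEmpty_or_nonempty T with hT | hT
  · exact Eventually.of_forall fun x _ t => isEmptyElim t
  have hfc : Continuous fun t => f (y t) := continuous_iff_continuousAt.2 fun t =>
    ContinuousAt.comp (f := y) (g := f) (hf t).continuousAt hy.continuousAt
  have hdc : Continuous fun t => fderiv ℝ f (y t) (v 0 t) := continuous_iff_continuousAt.2 fun t =>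
    (ContinuousAt.comp (f := y) (g := fderiv ℝ f)
      ((hf t).fderiv_right (m := 0) le_rfl).continuousAt hy.continuousAt).clm_apply
      (hv.comp (continuous_const.prodMk continuous_id)).continuousAt
  obtain ⟨t₁, -, ht₁⟩ := isCompact_univ.exists_isMaxOn univ_nonempty (hfc.min hdc).continuousOn
  obtain ⟨B, hB⟩ := isCompact_univ.exists_bound_of_continuousOn hdc.continuousOn
  -- The maximum over time of the minimum of constraint and slope is negative: at each time the
  -- constraint has slack `κ` or decreases at rate at least `κ`.
  set κ : ℝ := -min (f (y t₁)) (fderiv ℝ f (y t₁) (v 0 t₁)) with hκ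
  have hκ0 : 0 < κ := by
    rw [hκ, Left.neg_pos_iff]
    rcases (hneg t₁).lt_or_eq with h | h
    · exact (min_le_left _ _).trans_lt h
    · exact (min_le_right _ _).trans_lt (hstrict t₁ h)
  have hmin : ∀ t, f (y t) ≤ -κ ∨ fderiv ℝ f (y t) (v 0 t) ≤ -κ := fun t => by
    have h1 : min (f (y t)) (fderiv ℝ f (y t) (v 0 t)) ≤ -κ := by
      rw [hκ, neg_neg]
      exact ht₁ (mem_univ t)
    exact min_le_iff.1 h1
  have hB0 : 0 ≤ B := (norm_nonneg _).trans (hB t₁ (mem_univ _))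
  have hsmall : ∀ᶠ x : ℝ × W in 𝓝 0, x.1 * (B + κ) < κ := by
    have : Continuous fun x : ℝ × W => x.1 * (B + κ) := continuous_fst.mul continuous_const
    exact this.continuousAt.eventually (gt_mem_nhds (by simpa using hκ0))
  filter_upwards [eventually_first_order_estimate hy hf hv hκ0, hsmall] with x h1 h2 hx t
  have h3 := (abs_le.1 (h1 t)).2
  rw [abs_of_pos hx] at h3
  rcases hmin t with h | h
  · have h4 := (abs_le.1 (hB t (mem_univ t))).2
    have h5 : x.1 * fderiv ℝ f (y t) (v 0 t) ≤ x.1 * B := by gcongr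
    linarith
  · have h5 : x.1 * fderiv ℝ f (y t) (v 0 t) ≤ x.1 * -κ := by gcongr
    linarith [hneg t]

/-! ### Variations of an optimal trajectory. -/

/-- The trajectories of a linear control system form a vector space. -/
def linearTrajectories {E U : Type*} [NormedAddCommGroup E] [NormedSpace ℝ E]
    [NormedAddCommGroup U] [NormedSpace ℝ U] (I : E × U →L[ℝ] E) (N : ℕ) (τ : ℕ → ℝ) :
    Submodule ℝ ((ℝ → E) × (ℕ → ℝ → U)) where
  carrier := {δ | IsLinearTrajectory I N τ δ.1 δ.2}
  add_mem' := fun {δ δ'} h h' l hl => ⟨(h l hl).1.add (h' l hl).1, fun t ht => by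
    refine (((h l hl).2 t ht).add ((h' l hl).2 t ht)).congr_deriv ?_
    rw [← map_add]
    rfl⟩
  zero_mem' := fun l _ => ⟨continuousOn_const, fun t _ => by
    refine (hasDerivWithinAt_const t _ (0 : E)).congr_deriv ?_
    exact (map_zero I).symm⟩
  smul_mem' := fun c δ h l hl => ⟨(h l hl).1.const_smul c, fun t ht => by
    refine (((h l hl).2 t ht).const_smul c).congr_deriv ?_
    rw [← map_smul]
    rfl⟩

section Flat
variable {m : ℕ} {k : Fin m → ℕ} {c b : ℕ}

/-- The integrator dynamics as a continuous linear map. -/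
noncomputable def integratorCLM (k : Fin m → ℕ) :
    FlatState k × FlatControl m →L[ℝ] FlatState k :=
  LinearMap.toContinuousLinearMap
    { toFun := fun z => integrator k z.1 z.2
      map_add' := fun x y => by
        funext q
        simp only [integrator, Prod.fst_add, Prod.snd_add, Pi.add_apply]
        split_ifs <;> rfl
      map_smul' := fun r x => by
        funext q
        simp only [integrator, Prod.smul_fst, Prod.smul_snd, Pi.smul_apply, RingHom.id_apply]
        split_ifs <;> rfl }

theorem integratorCLM_apply (z : FlatState k × FlatControl m) :
    integratorCLM k z = integrator k z.1 z.2 := rfl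

namespace FlatTrajectory

/-- The trajectory obtained by adding `δ` to the state and the control. -/
def perturb (p : FlatTrajectory k) (δ : (ℝ → FlatState k) × (ℕ → ℝ → FlatControl m)) :
    FlatTrajectory k where
  N := p.N
  τ := p.τ
  s := p.s + δ.1
  a := p.a + δ.2

/-- The linearized trajectories: since the dynamics are linear, these are the differences of
trajectories with the same junctions. -/
noncomputable def variations (p : FlatTrajectory k) :
    Submodule ℝ ((ℝ → FlatState k) × (ℕ → ℝ → FlatControl m)) :=
  linearTrajectories (integratorCLM k) p.N p.τ

/-- Value of a variation of state and control at time `t` in the `l`-th piece. -/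
def shift (δ : (ℝ → FlatState k) × (ℕ → ℝ → FlatControl m)) (l : ℕ) (t : ℝ) :
    FlatState k × FlatControl m :=
  (δ.1 t, δ.2 l t)

theorem continuousOn_shift {p : FlatTrajectory k}
    {δ : (ℝ → FlatState k) × (ℕ → ℝ → FlatControl m)} (hδ : δ ∈ p.variations) {l : ℕ}
    (hl : l < p.N) : ContinuousOn (shift δ l) (p.closedArc l) :=
  IsLinearTrajectory.continuousOn hδ hl

end FlatTrajectory

namespace FlatProblem
open FlatTrajectory

variable {P : FlatProblem k c b} {p : FlatTrajectory k}

/-- The derivative of the `j`-th constraint with respect to state and control along the `l`-th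
arc. -/
noncomputable def gradConstraint (P : FlatProblem k c b) (p : FlatTrajectory k) (l : ℕ) (t : ℝ)
    (j : Fin c) : FlatState k × FlatControl m →L[ℝ] ℝ :=
  fderiv ℝ (fun z => P.g z t j) (p.point l t)

/-- The derivative of the total cost. -/
noncomputable def costDeriv (P : FlatProblem k c b) (p : FlatTrajectory k)
    (δ : (ℝ → FlatState k) × (ℕ → ℝ → FlatControl m)) : ℝ :=
  fderiv ℝ P.Phi (p.point (p.N - 1) P.tf) (shift δ (p.N - 1) P.tf) +
    ∑ l ∈ Finset.range p.N, ∫ t in (p.τ l)..(p.τ (l + 1)),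
      fderiv ℝ P.Psi (p.point l t) (shift δ l t)

/-- Along the variation `δ` all active constraints decrease. -/
def IsStrict (P : FlatProblem k c b) (p : FlatTrajectory k)
    (δ : (ℝ → FlatState k) × (ℕ → ℝ → FlatControl m)) : Prop :=
  ∀ l < p.N, ∀ t ∈ p.closedArc l, ∀ j, P.g (p.point l t) t j = 0 →
    P.gradConstraint p l t j (shift δ l t) < 0

namespace IsFeasible

theorem pos_N (h : P.IsFeasible p) (htime : P.t0 < P.tf) : 0 < p.N := by
  rw [Nat.pos_iff_ne_zero]
  intro h0
  have h1 := h.tau_zero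
  have h2 := h.tau_last
  rw [h0] at h2
  linarith

theorem continuousOn_point (h : P.IsFeasible p) {l : ℕ} (hl : l < p.N) :
    ContinuousOn (p.point l) (p.closedArc l) :=
  ContinuousOn.prodMk (fun t ht => (h.dynamics l hl t ht).continuousWithinAt)
    (h.continuousOn_control l hl)

theorem tf_mem (h : P.IsFeasible p) (htime : P.t0 < P.tf) : P.tf ∈ p.closedArc (p.N - 1) := by
  have hN := h.pos_N htime
  have h1 := h.tau_lt (p.N - 1) (by omega)
  rw [FlatTrajectory.closedArc, ← h.tau_last]
  rw [Nat.sub_add_cancel hN] at h1 ⊢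
  exact ⟨h1.le, le_rfl⟩

theorem perturb (h : P.IsFeasible p) {δ : (ℝ → FlatState k) × (ℕ → ℝ → FlatControl m)}
    (hδ : δ ∈ p.variations)
    (hdom : ∀ l < p.N, ∀ t ∈ p.closedArc l, p.point l t + shift δ l t ∈ P.domain)
    (hcon : ∀ l < p.N, ∀ t ∈ p.closedArc l, ∀ j, P.g (p.point l t + shift δ l t) t j ≤ 0)
    (hbd : P.bdry ((p.s P.t0, p.s P.tf) + (δ.1 P.t0, δ.1 P.tf)) = 0) :
    P.IsFeasible (p.perturb δ) where
  tau_zero := h.tau_zero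
  tau_last := h.tau_last
  tau_lt := h.tau_lt
  continuousOn_control l hl := (h.continuousOn_control l hl).add (hδ l hl).1
  mem_domain := hdom
  dynamics l hl t ht := by
    refine ((h.dynamics l hl t ht).add ((hδ l hl).2 t ht)).congr_deriv ?_
    exact ((integratorCLM k).map_add (p.s t, p.a l t) (δ.1 t, δ.2 l t)).symm
  constraint := hcon
  boundary := hbd

end IsFeasible

theorem contDiffAt_constraint {n : WithTop ℕ∞} (hdomain : IsOpen P.domain)
    (hg : ContDiffOn ℝ n (fun z : (FlatState k × FlatControl m) × ℝ => P.g z.1 z.2)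
      (P.domain ×ˢ Set.univ)) {z : FlatState k × FlatControl m} (hz : z ∈ P.domain) (t : ℝ)
    (j : Fin c) :
    ContDiffAt ℝ n (fun y : (FlatState k × FlatControl m) × ℝ => P.g y.1 y.2 j) (z, t) :=
  contDiffAt_pi.1 (hg.contDiffAt ((hdomain.prod isOpen_univ).mem_nhds ⟨hz, mem_univ t⟩)) j

theorem fderiv_constraint_eq (hdomain : IsOpen P.domain)
    (hg : ContDiffOn ℝ 1 (fun z : (FlatState k × FlatControl m) × ℝ => P.g z.1 z.2)
      (P.domain ×ˢ Set.univ)) {z : FlatState k × FlatControl m} (hz : z ∈ P.domain) (t : ℝ)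
    (j : Fin c) :
    fderiv ℝ (fun z => P.g z t j) z =
      (fderiv ℝ (fun y : (FlatState k × FlatControl m) × ℝ => P.g y.1 y.2 j) (z, t)).comp
        (ContinuousLinearMap.inl ℝ (FlatState k × FlatControl m) ℝ) := by
  have h1 := ((contDiffAt_constraint hdomain hg hz t j).differentiableAt one_ne_zero).hasFDerivAt
  have h2 : HasFDerivAt (fun z : FlatState k × FlatControl m => (z, t))
      (ContinuousLinearMap.inl ℝ (FlatState k × FlatControl m) ℝ) z := by
    exact hasFDerivAt_prodMk_left z t
  exact (HasFDerivAt.comp z h1 h2).fderiv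

/-- First order optimality: the cost does not decrease along strict variations that are tangent
to the boundary conditions, if the boundary conditions are independent. -/
theorem IsOptimal.costDeriv_nonneg (htime : P.t0 < P.tf) (hdomain : IsOpen P.domain)
    (hPsi : ContDiffOn ℝ 1 P.Psi P.domain) (hPhi : ContDiffOn ℝ 1 P.Phi P.domain)
    (hg : ContDiffOn ℝ 1
      (fun z : (FlatState k × FlatControl m) × ℝ => P.g z.1 z.2) (P.domain ×ˢ Set.univ))
    (hopt : P.IsOptimal p) (hbdry : ContDiffAt ℝ 1 P.bdry (p.s P.t0, p.s P.tf))
    {δ : (ℝ → FlatState k) × (ℕ → ℝ → FlatControl m)} (hδ : δ ∈ p.variations)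
    (hstrict : P.IsStrict p δ)
    (hδb : fderiv ℝ P.bdry (p.s P.t0, p.s P.tf) (δ.1 P.t0, δ.1 P.tf) = 0)
    {ω : Fin b → (ℝ → FlatState k) × (ℕ → ℝ → FlatControl m)} (hω : ∀ e, ω e ∈ p.variations)
    (hωb : ∀ e, fderiv ℝ P.bdry (p.s P.t0, p.s P.tf) ((ω e).1 P.t0, (ω e).1 P.tf) =
      Pi.single e 1) :
    0 ≤ P.costDeriv p δ := by
  have hfeas := hopt.1
  have hN := hfeas.pos_N htime
  -- The variation `ω e` moves only the `e`-th linearized boundary value; coefficients tending to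
  -- `0` restore the boundary conditions exactly.
  let combo : (Fin b → ℝ) → (ℝ → FlatState k) × (ℕ → ℝ → FlatControl m) :=
    fun x => δ + ∑ e, x e • ω e
  have hcombo : ∀ x, combo x ∈ p.variations := fun x =>
    add_mem hδ (sum_mem fun e _ => Submodule.smul_mem _ _ (hω e))
  have hcombo0 : combo 0 = δ := by simp [combo]
  have hshift : ∀ x l t, shift (combo x) l t = shift δ l t + ∑ e, x e • shift (ω e) l t := by
    intro x l t
    ext q <;> simp [combo, shift, Prod.fst_sum, Prod.snd_sum, Finset.sum_apply]
  have hvc : ∀ l < p.N, Continuous fun x : (Fin b → ℝ) × p.closedArc l =>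
      shift (combo x.1) l x.2 := by
    intro l hl
    simp only [hshift]
    have h1 : ∀ η ∈ p.variations, Continuous fun x : (Fin b → ℝ) × p.closedArc l =>
        shift η l x.2 := fun η hη =>
      (continuousOn_iff_continuous_domRestrict.1 (continuousOn_shift hη hl)).comp continuous_snd
    exact (h1 δ hδ).add (continuous_finsetSum _ fun e _ =>
      ((continuous_apply e).comp continuous_fst).smul (h1 _ (hω e)))
  have hpc : ∀ l < p.N, Continuous fun t : p.closedArc l => p.point l t := fun l hl =>
    continuousOn_iff_continuous_domRestrict.1 (hfeas.continuousOn_point hl)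
  have : ∀ l, CompactSpace (p.closedArc l) := fun l => isCompact_iff_compactSpace.1 isCompact_Icc
  obtain ⟨x, hx, hroot⟩ := exists_curve_in_zero_set
    (hbdry.hasStrictFDerivAt one_ne_zero) hfeas.boundary hδb
    (D := ∑ e, (ContinuousLinearMap.proj e : (Fin b → ℝ) →L[ℝ] ℝ).smulRight
      ((ω e).1 P.t0, (ω e).1 P.tf)) (fun w => by
        rw [sum_apply, map_sum]
        simp only [ContinuousLinearMap.smulRight_apply, ContinuousLinearMap.proj_apply, map_smul,
          hωb]
        conv_rhs => rw [← Finset.univ_sum_single w]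
        refine Finset.sum_congr rfl fun e _ => ?_
        rw [← Pi.single_smul]
        simp)
  by_contra! hcost
  have hT : 0 < P.tf - P.t0 := sub_pos.2 htime
  -- The final cost contributes an error `κ ε` and the running cost `κ ε (tf - t0)`; together they
  -- use up half of the first-order decrease.
  set κ : ℝ := -P.costDeriv p δ / (2 * (1 + (P.tf - P.t0))) with hκ
  have hκ0 : 0 < κ := div_pos (by linarith) (by linarith)
  have edom : ∀ᶠ y : ℝ × (Fin b → ℝ) in 𝓝 0, ∀ l ∈ Finset.range p.N, ∀ t : p.closedArc l,
      p.point l t + y.1 • shift (combo y.2) l t ∈ P.domain :=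
    (eventually_all_finset _).2 fun l hl => by
      rw [Finset.mem_range] at hl
      exact eventually_mem_open hdomain (hpc l hl) (fun t => hfeas.mem_domain l hl t t.2)
        (v := fun x (t : p.closedArc l) => shift (combo x) l t) (hvc l hl)
  have econ : ∀ᶠ y : ℝ × (Fin b → ℝ) in 𝓝 0, ∀ l ∈ Finset.range p.N, ∀ j : Fin c, 0 < y.1 →
      ∀ t : p.closedArc l, P.g (p.point l t + y.1 • shift (combo y.2) l t) t j ≤ 0 := by
    refine (eventually_all_finset _).2 fun l hl => eventually_all.2 fun j => ?_
    rw [Finset.mem_range] at hl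
    -- Time is an additional coordinate with zero variation, which makes the constraint one fixed
    -- function.
    have h1 := eventually_nonpos_of_strict
      (f := fun y : (FlatState k × FlatControl m) × ℝ => P.g y.1 y.2 j)
      (y := fun t : p.closedArc l => (p.point l t, (t : ℝ)))
      (v := fun x (t : p.closedArc l) => (shift (combo x) l t, (0 : ℝ)))
      ((hpc l hl).prodMk continuous_subtype_val)
      (fun t => contDiffAt_constraint hdomain hg (hfeas.mem_domain l hl t t.2) t j)
      ((hvc l hl).prodMk continuous_const)
      (fun t => hfeas.constraint l hl t t.2 j) (fun t ht => by
        have h2 := hstrict l hl t t.2 j ht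
        rw [gradConstraint, fderiv_constraint_eq hdomain hg (hfeas.mem_domain l hl t t.2)] at h2
        rw [hcombo0]
        exact h2)
    refine h1.mono fun y hy hpos t => ?_
    have := hy hpos t
    simpa using this
  have epsi : ∀ᶠ y : ℝ × (Fin b → ℝ) in 𝓝 0, ∀ l ∈ Finset.range p.N, ∀ t : p.closedArc l,
      |P.Psi (p.point l t + y.1 • shift (combo y.2) l t) - P.Psi (p.point l t) -
        y.1 * fderiv ℝ P.Psi (p.point l t) (shift (combo 0) l t)| ≤ κ * |y.1| :=
    (eventually_all_finset _).2 fun l hl => by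
      rw [Finset.mem_range] at hl
      exact eventually_first_order_estimate (hpc l hl)
        (fun t => hPsi.contDiffAt (hdomain.mem_nhds (hfeas.mem_domain l hl t t.2)))
        (v := fun x (t : p.closedArc l) => shift (combo x) l t) (hvc l hl) hκ0
  have hNlt : p.N - 1 < p.N := by omega
  have htf := hfeas.tf_mem htime
  have ephi : ∀ᶠ y : ℝ × (Fin b → ℝ) in 𝓝 0, ∀ _ : Unit,
      |P.Phi (p.point (p.N - 1) P.tf + y.1 • shift (combo y.2) (p.N - 1) P.tf) -
        P.Phi (p.point (p.N - 1) P.tf) -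
        y.1 * fderiv ℝ P.Phi (p.point (p.N - 1) P.tf) (shift (combo 0) (p.N - 1) P.tf)| ≤
        κ * |y.1| :=
    eventually_first_order_estimate (T := Unit) (y := fun _ => p.point (p.N - 1) P.tf)
      continuous_const
      (fun _ => hPhi.contDiffAt (hdomain.mem_nhds (hfeas.mem_domain _ hNlt _ htf)))
      (v := fun x (_ : Unit) => shift (combo x) (p.N - 1) P.tf)
      ((hvc _ hNlt).comp (continuous_fst.prodMk (continuous_const (y := ⟨P.tf, htf⟩)))) hκ0
  have hcurve : Tendsto (fun ε : ℝ => (ε, x ε)) (𝓝[>] 0) (𝓝 (0 : ℝ × (Fin b → ℝ))) := by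
    have : Tendsto (fun ε : ℝ => (ε, x ε)) (𝓝[>] 0) (𝓝 ((0 : ℝ), (0 : Fin b → ℝ))) :=
      (tendsto_id.mono_left nhdsWithin_le_nhds).prodMk_nhds hx
    exact this
  have hall := hcurve.eventually (((edom.and econ).and epsi).and ephi)
  obtain ⟨ε, ⟨⟨⟨⟨hdom, hcon⟩, hpsi⟩, hphi⟩, hbd⟩, hε⟩ :=
    ((hall.and hroot).and eventually_mem_nhdsWithin).exists
  replace hε : 0 < ε := hε
  simp only [abs_of_pos hε, hcombo0] at hpsi hphi
  have hsm : ∀ l t, shift (ε • combo (x ε)) l t = ε • shift (combo (x ε)) l t := fun l t => rfl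
  have hqfeas : P.IsFeasible (p.perturb (ε • combo (x ε))) := by
    refine hfeas.perturb (Submodule.smul_mem _ _ (hcombo _)) (fun l hl t ht => ?_)
      (fun l hl t ht j => ?_) ?_
    · exact hdom l (Finset.mem_range.2 hl) ⟨t, ht⟩
    · exact hcon l (Finset.mem_range.2 hl) j hε ⟨t, ht⟩
    · convert hbd using 3
      ext q <;> simp [combo, Prod.fst_sum, Prod.snd_sum, Finset.sum_apply]
  have hle := hopt.2 _ hqfeas
  have hint : ∀ l ∈ Finset.range p.N,
      |(∫ t in (p.τ l)..(p.τ (l + 1)), P.Psi ((p.perturb (ε • combo (x ε))).point l t)) -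
        (∫ t in (p.τ l)..(p.τ (l + 1)), P.Psi (p.point l t)) -
        ε * ∫ t in (p.τ l)..(p.τ (l + 1)), fderiv ℝ P.Psi (p.point l t) (shift δ l t)| ≤
      κ * ε * (p.τ (l + 1) - p.τ l) := by
    intro l hl
    have hl' := Finset.mem_range.1 hl
    have hlt := hfeas.tau_lt l hl'
    have i1 : IntervalIntegrable (fun t => P.Psi ((p.perturb (ε • combo (x ε))).point l t))
        MeasureTheory.volume (p.τ l) (p.τ (l + 1)) :=
      (hPsi.continuousOn.comp (hqfeas.continuousOn_point hl')
        (fun t ht => hqfeas.mem_domain l hl' t ht)).intervalIntegrable_of_Icc hlt.le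
    have i2 : IntervalIntegrable (fun t => P.Psi (p.point l t))
        MeasureTheory.volume (p.τ l) (p.τ (l + 1)) :=
      (hPsi.continuousOn.comp (hfeas.continuousOn_point hl')
        (fun t ht => hfeas.mem_domain l hl' t ht)).intervalIntegrable_of_Icc hlt.le
    have i3 : IntervalIntegrable (fun t => fderiv ℝ P.Psi (p.point l t) (shift δ l t))
        MeasureTheory.volume (p.τ l) (p.τ (l + 1)) :=
      (((hPsi.continuousOn_fderiv_of_isOpen hdomain le_rfl).comp (hfeas.continuousOn_point hl')
        (fun t ht => hfeas.mem_domain l hl' t ht)).clm_apply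
        (continuousOn_shift hδ hl')).intervalIntegrable_of_Icc hlt.le
    rw [← intervalIntegral.integral_const_mul, ← intervalIntegral.integral_sub i1 i2,
      ← intervalIntegral.integral_sub (i1.sub i2) (i3.const_mul ε)]
    have h := intervalIntegral.norm_integral_le_of_norm_le_const (a := p.τ l) (b := p.τ (l + 1))
      (C := κ * ε) (f := fun t => P.Psi ((p.perturb (ε • combo (x ε))).point l t) -
        P.Psi (p.point l t) - ε * fderiv ℝ P.Psi (p.point l t) (shift δ l t)) (fun t ht => by
          rw [uIoc_of_le hlt.le] at ht
          exact hpsi l hl ⟨t, ht.1.le, ht.2⟩)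
    rwa [abs_of_pos (sub_pos.2 hlt)] at h
  have hsum : (∑ l ∈ Finset.range p.N,
        ∫ t in (p.τ l)..(p.τ (l + 1)), P.Psi ((p.perturb (ε • combo (x ε))).point l t)) -
      (∑ l ∈ Finset.range p.N, ∫ t in (p.τ l)..(p.τ (l + 1)), P.Psi (p.point l t)) -
      ε * ∑ l ∈ Finset.range p.N, ∫ t in (p.τ l)..(p.τ (l + 1)),
        fderiv ℝ P.Psi (p.point l t) (shift δ l t) ≤ κ * ε * (P.tf - P.t0) := by
    rw [← hfeas.tau_last, ← hfeas.tau_zero, ← Finset.sum_range_sub p.τ, Finset.mul_sum,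
      Finset.mul_sum, ← Finset.sum_sub_distrib, ← Finset.sum_sub_distrib]
    exact Finset.sum_le_sum fun l hl => (abs_le.1 (hint l hl)).2
  have hphi' := (abs_le.1 (hphi ())).2
  have hκ' : κ * (2 * (1 + (P.tf - P.t0))) = -P.costDeriv p δ :=
    div_mul_cancel₀ _ (by positivity)
  have hcq : P.cost (p.perturb (ε • combo (x ε))) =
      P.Phi (p.point (p.N - 1) P.tf + ε • shift (combo (x ε)) (p.N - 1) P.tf) +
      ∑ l ∈ Finset.range p.N,
        ∫ t in (p.τ l)..(p.τ (l + 1)), P.Psi ((p.perturb (ε • combo (x ε))).point l t) := rfl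
  rw [hcq, cost] at hle
  have hfin : 0 ≤ ε * P.costDeriv p δ + κ * ε * (1 + (P.tf - P.t0)) := by
    rw [costDeriv]
    linarith
  have : ε * P.costDeriv p δ + κ * ε * (1 + (P.tf - P.t0)) = ε * P.costDeriv p δ / 2 := by
    linear_combination (ε / 2) * hκ'
  rw [this] at hfin
  nlinarith

/-- Fritz John conditions of the optimal control problem in integrated form. -/
theorem IsOptimal.exists_fritzJohn (htime : P.t0 < P.tf) (hdomain : IsOpen P.domain)
    (hPsi : ContDiffOn ℝ 1 P.Psi P.domain) (hPhi : ContDiffOn ℝ 1 P.Phi P.domain)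
    (hg : ContDiffOn ℝ 1
      (fun z : (FlatState k × FlatControl m) × ℝ => P.g z.1 z.2) (P.domain ×ˢ Set.univ))
    (hopt : P.IsOptimal p) (hbdry : ContDiffAt ℝ 1 P.bdry (p.s P.t0, p.s P.tf)) :
    ∃ (nu : Fin b → ℝ) (lam₀ : ℝ), 0 ≤ lam₀ ∧ (nu ≠ 0 ∨ lam₀ ≠ 0) ∧
      ∀ δ ∈ p.variations, P.IsStrict p δ →
        0 ≤ ∑ e, nu e * fderiv ℝ P.bdry (p.s P.t0, p.s P.tf) (δ.1 P.t0, δ.1 P.tf) e +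
          lam₀ * P.costDeriv p δ := by
  have hfeas := hopt.1
  have hi : ∀ δ ∈ p.variations, ∀ l ∈ Finset.range p.N,
      IntervalIntegrable (fun t => fderiv ℝ P.Psi (p.point l t) (shift δ l t))
        MeasureTheory.volume (p.τ l) (p.τ (l + 1)) := fun δ hδ l hl => by
    have hl' := Finset.mem_range.1 hl
    exact (((hPsi.continuousOn_fderiv_of_isOpen hdomain le_rfl).comp (hfeas.continuousOn_point hl')
      (fun t ht => hfeas.mem_domain l hl' t ht)).clm_apply
      (continuousOn_shift hδ hl')).intervalIntegrable_of_Icc (hfeas.tau_lt l hl').le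
  let T : p.variations →ₗ[ℝ] Fin b → ℝ :=
    { toFun := fun δ => fderiv ℝ P.bdry (p.s P.t0, p.s P.tf) (δ.1.1 P.t0, δ.1.1 P.tf)
      map_add' := fun δ η => by
        rw [← map_add]
        rfl
      map_smul' := fun r δ => by
        rw [RingHom.id_apply, ← map_smul]
        rfl }
  let J : p.variations →ₗ[ℝ] ℝ :=
    { toFun := fun δ => P.costDeriv p δ.1
      map_add' := fun δ η => by
        have h1 : ∀ l t, shift (δ + η).1 l t = shift δ.1 l t + shift η.1 l t := fun _ _ => rfl
        simp only [costDeriv, h1, map_add]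
        rw [Finset.sum_congr rfl fun l hl =>
          intervalIntegral.integral_add (hi δ.1 δ.2 l hl) (hi η.1 η.2 l hl),
          Finset.sum_add_distrib]
        ring
      map_smul' := fun r δ => by
        have h1 : ∀ l t, shift (r • δ).1 l t = r • shift δ.1 l t := fun _ _ => rfl
        simp only [costDeriv, h1, map_smul, smul_eq_mul, intervalIntegral.integral_const_mul,
          RingHom.id_apply, ← Finset.mul_sum]
        ring }
  have hC : Convex ℝ {δ : p.variations | P.IsStrict p δ.1} := by
    intro δ hδ η hη x y hx hy hxy l hl t ht j hj
    have h1 : shift (x • δ + y • η).1 l t = x • shift δ.1 l t + y • shift η.1 l t := rfl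
    have h2 := hδ l hl t ht j hj
    have h3 := hη l hl t ht j hj
    rw [h1, map_add, map_smul, map_smul, smul_eq_mul, smul_eq_mul]
    rcases hx.eq_or_lt with rfl | hx'
    · rw [zero_add] at hxy
      subst hxy
      simpa using h3
    · nlinarith
  obtain ⟨nu, lam₀, h1, h2, h3⟩ := exists_fritzJohn_multipliers T J hC fun hT δ hδ hδT => by
    -- Surjectivity supplies the correcting variations.
    choose ω hω using fun e : Fin b => hT (Pi.single e 1)
    exact hopt.costDeriv_nonneg htime hdomain hPsi hPhi hg hbdry δ.2 hδ hδT
      (ω := fun e => (ω e).1) (fun e => (ω e).2) hω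
  exact ⟨nu, lam₀, h1, h2, fun δ hδ hs => h3 ⟨δ, hδ⟩ hs⟩

end FlatProblem
end Flat

/-! ### Regularity and elimination of costates. -/

/-- Bootstrapping from continuity: every order reached by `x` passes to `x'` and so raises the order
of `x` by one. -/
theorem contDiffOn_succ_of_hasDerivAt {F : Type*} [NormedAddCommGroup F] [NormedSpace ℝ F]
    {x x' : ℝ → F} {O : Set ℝ} (hO : IsOpen O) (r : ℕ) (hx : ∀ t ∈ O, HasDerivAt x (x' t) t)
    (h : ∀ j : ℕ, j ≤ r → ContDiffOn ℝ j x O → ContDiffOn ℝ j x' O) :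
    ContDiffOn ℝ (r + 1) x O := by
  have hd : DifferentiableOn ℝ x O := fun t ht => (hx t ht).differentiableAt.differentiableWithinAt
  have key : ∀ j : ℕ, j ≤ r → ContDiffOn ℝ (j + 1) x O := by
    intro j
    have step : ∀ i : ℕ, i ≤ r → ContDiffOn ℝ i x O → ContDiffOn ℝ (i + 1) x O := fun i hi hc =>
      (contDiffOn_succ_iff_deriv_of_isOpen hO).2 ⟨hd, fun h => by simp at h,
        (h i hi hc).congr fun t ht => (hx t ht).deriv⟩
    induction j with
    | zero => exact fun hj => step 0 hj (by simpa using hd.continuousOn)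
    | succ j ih =>
      intro hj
      have := ih (by omega)
      exact step (j + 1) hj (by exact_mod_cast this)
  exact key r le_rfl

/-- Elimination of the costates of a chain of integrators. -/
theorem costate_eq_alternating_sum {O : Set ℝ} (hO : IsOpen O) {K : ℕ} {lam Q : ℕ → ℝ → ℝ}
    (hQ : ∀ n ≤ K, ContDiffOn ℝ K (Q n) O)
    (hlam : ∀ n < K, ∀ t ∈ O, HasDerivAt (lam (n + 1)) (-(lam n t + Q n t)) t)
    (hK : ∀ t ∈ O, lam K t + Q K t = 0) {n : ℕ} (hn : n ≤ K) :
    ∀ t ∈ O, lam n t =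
      ∑ j ∈ Finset.range (K + 1 - n), (-1 : ℝ) ^ (j + 1) * iteratedDeriv j (Q (n + j)) t := by
  -- Downwards from `λ_K = -Q_K`, using `λ_n = -Q_n - λ_{n+1}'`.
  induction hn using Nat.decreasingInduction with
  | self =>
    intro t ht
    have := hK t ht
    simp
    linarith
  | of_succ n hn ih =>
    intro t ht
    have h1 : HasDerivAt (lam (n + 1)) (∑ j ∈ Finset.range (K + 1 - (n + 1)),
        (-1 : ℝ) ^ (j + 1) * iteratedDeriv (j + 1) (Q (n + 1 + j)) t) t := by
      have h2 : HasDerivAt (fun s => ∑ j ∈ Finset.range (K + 1 - (n + 1)),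
          (-1 : ℝ) ^ (j + 1) * iteratedDeriv j (Q (n + 1 + j)) s)
          (∑ j ∈ Finset.range (K + 1 - (n + 1)),
            (-1 : ℝ) ^ (j + 1) * iteratedDeriv (j + 1) (Q (n + 1 + j)) t) t := by
        refine HasDerivAt.fun_sum fun j hj => HasDerivAt.const_mul _ ?_
        rw [Finset.mem_range] at hj
        rw [iteratedDeriv_succ]
        have hc : ContDiffAt ℝ K (Q (n + 1 + j)) t :=
          (hQ (n + 1 + j) (by omega)).contDiffAt (hO.mem_nhds ht)
        have hd := (hc.iteratedFDeriv_right (m := 1) (i := j)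
          (by exact_mod_cast (by omega : 1 + j ≤ K))).differentiableAt one_ne_zero
        rw [iteratedDeriv_eq_equiv_comp]
        exact ((LinearIsometryEquiv.differentiable _).differentiableAt.comp t hd).hasDerivAt
      exact h2.congr_of_eventuallyEq (eventually_of_mem (hO.mem_nhds ht) ih)
    have h3 := h1.unique (hlam n hn t ht)
    have h4 : K + 1 - n = (K + 1 - (n + 1)) + 1 := by omega
    rw [h4, Finset.sum_range_succ']
    have h5 : ∑ j ∈ Finset.range (K + 1 - (n + 1)),
        (-1 : ℝ) ^ (j + 1 + 1) * iteratedDeriv (j + 1) (Q (n + (j + 1))) t =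
        -∑ j ∈ Finset.range (K + 1 - (n + 1)),
          (-1 : ℝ) ^ (j + 1) * iteratedDeriv (j + 1) (Q (n + 1 + j)) t := by
      rw [← Finset.sum_neg_distrib]
      refine Finset.sum_congr rfl fun j _ => ?_
      rw [show n + (j + 1) = n + 1 + j by ring]
      ring
    rw [h5, h3]
    simp

section Flat
variable {m : ℕ} {k : Fin m → ℕ} {c b : ℕ}

/-- It makes `lam (I (jetDir k i (n + 1)))` the costate of the `n`-th derivative of output `i`, so
the adjoint equation becomes a recursion in `n` that includes the control at `n + 1 = k i`. -/
theorem jetDir_eq_integrator {i : Fin m} {n : ℕ} (hn : n < k i) :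
    jetDir k i n = (integratorCLM k (jetDir k i (n + 1)), 0) := by
  rw [jetDir, dif_pos hn, integratorCLM_apply]
  congr 1
  funext ⟨i', n'⟩
  by_cases h1 : n + 1 < k i
  · simp only [jetDir, dif_pos h1, integrator]
    by_cases hi : i' = i
    · subst hi
      split_ifs with h2
      · simp only [Pi.single_apply, Sigma.mk.injEq, heq_eq_eq, true_and, Fin.ext_iff,
          Nat.add_right_cancel_iff]
      · rw [Pi.single_eq_of_ne]
        · rfl
        · simp only [ne_eq, Sigma.mk.injEq, heq_eq_eq, true_and, Fin.ext_iff]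
          intro h
          rw [h] at h2
          exact h2 h1
    · rw [Pi.single_eq_of_ne (by simp [hi])]
      split_ifs with h2
      · rw [Pi.single_eq_of_ne (by simp [hi])]
      · rfl
  · simp only [jetDir, dif_neg h1, integrator]
    by_cases hi : i' = i
    · subst hi
      have := n'.2
      simp only [Pi.single_apply, Sigma.mk.injEq, heq_eq_eq, true_and, Fin.ext_iff, Pi.zero_apply,
        if_true]
      split_ifs with h2 h3 h3
      · omega
      · rfl
      · rfl
      · omega
    · rw [Pi.single_eq_of_ne (by simp [hi])]
      split_ifs with h2
      · rfl
      · rw [Pi.single_eq_of_ne hi]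

/-- This ends the recursion: the output itself drives no state coordinate. A chain of length `0` is
covered, its control driving nothing. -/
theorem integratorCLM_jetDir_zero (i : Fin m) : integratorCLM k (jetDir k i 0) = 0 := by
  rw [integratorCLM_apply]
  funext ⟨i', n'⟩
  have := n'.2
  by_cases h0 : 0 < k i
  · simp only [jetDir, dif_pos h0, integrator]
    split_ifs with h
    · rw [Pi.single_eq_of_ne]
      · rfl
      · intro h'
        simp only [Sigma.mk.injEq] at h'
        obtain ⟨rfl, h'⟩ := h'
        simp [Fin.ext_iff] at h'
    · rfl
  · simp only [jetDir, dif_neg h0, integrator]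
    split_ifs with h
    · rfl
    · rw [Pi.single_eq_of_ne]
      · rfl
      · rintro rfl
        omega

theorem jetDir_top (i : Fin m) : jetDir k i (k i) = (0, Pi.single i 1) := by
  simp [jetDir]

theorem sum_single_mul (lam : FlatState k →L[ℝ] ℝ) (d : FlatState k) :
    ∑ q, lam (Pi.single q 1) * d q = lam d := by
  conv_rhs => rw [← Finset.univ_sum_single d]
  rw [map_sum]
  refine Finset.sum_congr rfl fun q _ => ?_
  have : (Pi.single q (d q) : FlatState k) = d q • Pi.single q 1 := by
    rw [← Pi.single_smul]; simp
  rw [this, map_smul, smul_eq_mul, mul_comm]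

/-! ### Multipliers along the optimal trajectory. -/

namespace FlatProblem
open FlatTrajectory

variable {P : FlatProblem k c b} {p : FlatTrajectory k}

/-- The set of active constraints. -/
def activeSet (P : FlatProblem k c b) (p : FlatTrajectory k) (l : ℕ) (t : ℝ) : Set (Fin c) :=
  {j | P.g (p.point l t) t j = 0}

/-- The derivative with respect to state and control of the Hamiltonian with cost multiplier
`lam₀`. -/
noncomputable def hamiltonianDeriv (P : FlatProblem k c b) (p : FlatTrajectory k) (lam₀ : ℝ)
    (lam : ℝ → FlatState k →L[ℝ] ℝ) (mu : ℕ → ℝ → Fin c → ℝ) (l : ℕ) (t : ℝ) :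
    FlatState k × FlatControl m →L[ℝ] ℝ :=
  (lam t).comp (integratorCLM k) + lam₀ • fderiv ℝ P.Psi (p.point l t) +
    ∑ j, mu l t j • P.gradConstraint p l t j

theorem ActiveGradientsIndependent.linearIndependent (h : P.ActiveGradientsIndependent p) {l : ℕ}
    (hl : l < p.N) {t : ℝ} (ht : t ∈ p.closedArc l) :
    LinearIndependent ℝ (fun j : P.activeSet p l t => (P.gradConstraint p l t j).comp
      (ContinuousLinearMap.inr ℝ (FlatState k) (FlatControl m))) := by
  let ev : (FlatControl m →L[ℝ] ℝ) →ₗ[ℝ] (Fin m → ℝ) :=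
    { toFun := fun φ i => φ (Pi.single i 1)
      map_add' := fun _ _ => rfl
      map_smul' := fun _ _ => rfl }
  refine LinearIndependent.of_comp ev ?_
  have hfun : (ev ∘ fun j : P.activeSet p l t => (P.gradConstraint p l t j).comp
      (ContinuousLinearMap.inr ℝ (FlatState k) (FlatControl m))) =
      fun (j : P.activeSet p l t) i =>
        jetPartial (fun z => P.g z t j) i (k i) (p.point l t) := by
    funext j i
    simp only [jetPartial, jetDir_top]
    rfl
  rw [hfun]
  exact h l hl t ht

/-- The gradient at fixed time is a restriction of the joint derivative, so it can be composed with
the curve `t ↦ (point, t)`. Order `0` serves on closed arcs, order `r` on open ones. -/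
theorem contDiffOn_gradConstraint (hdomain : IsOpen P.domain)
    (hg : ContDiffOn ℝ 1
      (fun z : (FlatState k × FlatControl m) × ℝ => P.g z.1 z.2) (P.domain ×ˢ Set.univ))
    {n : WithTop ℕ∞} (hg' : ContDiffOn ℝ (n + 1)
      (fun z : (FlatState k × FlatControl m) × ℝ => P.g z.1 z.2) (P.domain ×ˢ Set.univ))
    {l : ℕ} {O : Set ℝ} (hO : ∀ t ∈ O, p.point l t ∈ P.domain)
    (hp : ContDiffOn ℝ n (p.point l) O) (j : Fin c) :
    ContDiffOn ℝ n (fun t => P.gradConstraint p l t j) O := by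
  have hopen : IsOpen (P.domain ×ˢ (Set.univ : Set ℝ)) := hdomain.prod isOpen_univ
  have h1 : ContDiffOn ℝ n (fderiv ℝ
      (fun y : (FlatState k × FlatControl m) × ℝ => P.g y.1 y.2 j)) (P.domain ×ˢ Set.univ) :=
    (contDiffOn_pi.1 hg' j).fderiv_of_isOpen hopen le_rfl
  have h2 := h1.comp (hp.prodMk contDiffOn_id) fun t ht => ⟨hO t ht, mem_univ _⟩
  exact (h2.clm_comp contDiffOn_const).congr fun t ht =>
    fderiv_constraint_eq hdomain hg (hO t ht) t j

/-- Adjoint arc and multipliers from the Fritz John conditions in integrated form. -/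
theorem exists_adjoint (htime : P.t0 < P.tf) (hdomain : IsOpen P.domain)
    (hPsi : ContDiffOn ℝ 1 P.Psi P.domain)
    (hg : ContDiffOn ℝ 1
      (fun z : (FlatState k × FlatControl m) × ℝ => P.g z.1 z.2) (P.domain ×ˢ Set.univ))
    (hfeas : P.IsFeasible p) (hindep : P.ActiveGradientsIndependent p) {nu : Fin b → ℝ} {lam₀ : ℝ}
    (hFJ : ∀ δ ∈ p.variations, P.IsStrict p δ →
      0 ≤ ∑ e, nu e * fderiv ℝ P.bdry (p.s P.t0, p.s P.tf) (δ.1 P.t0, δ.1 P.tf) e +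
        lam₀ * P.costDeriv p δ) :
    ∃ (lam : ℝ → FlatState k →L[ℝ] ℝ) (mu : ℕ → ℝ → Fin c → ℝ),
      ContinuousOn lam (Icc P.t0 P.tf) ∧
      (∀ d, lam P.t0 d = -∑ e, nu e * fderiv ℝ P.bdry (p.s P.t0, p.s P.tf) (d, 0) e) ∧
      (∀ l < p.N, ∀ t ∈ p.openArc l,
        (∀ j, 0 ≤ mu l t j) ∧ (∀ j, j ∉ P.activeSet p l t → mu l t j = 0) ∧
        (∀ w, P.hamiltonianDeriv p lam₀ lam mu l t (0, w) = 0) ∧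
        HasDerivAt lam (-(P.hamiltonianDeriv p lam₀ lam mu l t).comp
          (ContinuousLinearMap.inl ℝ (FlatState k) (FlatControl m))) t) ∧
      (lam₀ = 0 → ∀ d, lam P.tf d =
        ∑ e, nu e * fderiv ℝ P.bdry (p.s P.t0, p.s P.tf) (0, d) e) := by
  let pair : (Fin b → ℝ) →L[ℝ] ℝ := ∑ e, nu e • ContinuousLinearMap.proj e
  have hpair : ∀ y, pair y = ∑ e, nu e * y e := fun y => by simp [pair]
  let B := pair.comp (fderiv ℝ P.bdry (p.s P.t0, p.s P.tf))
  let β₀ : FlatState k →L[ℝ] ℝ := B.comp (ContinuousLinearMap.inl ℝ _ _)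
  let βe : FlatState k →L[ℝ] ℝ := B.comp (ContinuousLinearMap.inr ℝ _ _)
  -- Through the final cost `βf` may depend on the control. That part vanishes for `lam₀ = 0`, the
  -- one case in which final transversality is needed.
  let βf : FlatState k × FlatControl m →L[ℝ] ℝ :=
    βe.comp (ContinuousLinearMap.fst ℝ _ _) + lam₀ • fderiv ℝ P.Phi (p.point (p.N - 1) P.tf)
  have hpc : ∀ l < p.N, ContinuousOn (p.point l) (p.closedArc l) := fun l hl =>
    hfeas.continuousOn_point hl
  have hA : ∀ l < p.N, ∀ t ∈ p.closedArc l,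
      ∀ᶠ s in 𝓝[p.closedArc l] t, P.activeSet p l s ⊆ P.activeSet p l t := by
    intro l hl t ht
    have h1 : ∀ j, ∀ᶠ s in 𝓝[p.closedArc l] t, j ∈ P.activeSet p l s → j ∈ P.activeSet p l t := by
      intro j
      by_cases hj : j ∈ P.activeSet p l t
      · exact Eventually.of_forall fun _ _ => hj
      · have hc : ContinuousWithinAt (fun s => P.g (p.point l s) s j) (p.closedArc l) t :=
          ContinuousAt.comp_continuousWithinAt
            (g := fun y : (FlatState k × FlatControl m) × ℝ => P.g y.1 y.2 j)
            (f := fun s => (p.point l s, s))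
            (contDiffAt_constraint hdomain hg (hfeas.mem_domain l hl t ht) t j).continuousAt
            ((hpc l hl t ht).prodMk continuousWithinAt_id)
        exact (hc.eventually_ne hj).mono fun s hs h => absurd h hs
    exact (eventually_all.2 h1).mono fun s hs j hj => hs j hj
  obtain ⟨lam, mu, h1, h2, h3, h4⟩ := exists_adjoint_of_nonneg (integratorCLM k)
    (hfeas.pos_N htime) hfeas.tau_lt (γ := P.gradConstraint p) (A := P.activeSet p)
    (fun l hl j => (contDiffOn_gradConstraint (n := 0) hdomain hg (by simpa using hg)
      (hfeas.mem_domain l hl) (contDiffOn_zero.2 (hpc l hl)) j).continuousOn) hA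
    (fun l hl t ht => hindep.linearIndependent hl ht)
    (ψ := fun l t => lam₀ • fderiv ℝ P.Psi (p.point l t))
    (fun l hl => ((hPsi.continuousOn_fderiv_of_isOpen hdomain le_rfl).comp (hpc l hl)
      (fun t ht => hfeas.mem_domain l hl t ht)).const_smul lam₀) β₀ βf (by
      intro σ u hσ hstrict
      have h := hFJ (σ, u) hσ hstrict
      rw [hfeas.tau_zero, hfeas.tau_last]
      have e1 : β₀ (σ P.t0) + βe (σ P.tf) = ∑ e, nu e *
          fderiv ℝ P.bdry (p.s P.t0, p.s P.tf) (σ P.t0, σ P.tf) e := by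
        rw [← hpair]
        have : ((σ P.t0, σ P.tf) : FlatState k × FlatState k) = (σ P.t0, 0) + (0, σ P.tf) := by
          simp
        rw [this, map_add, map_add]
        rfl
      have e2 : βf (σ P.tf, u (p.N - 1) P.tf) = βe (σ P.tf) +
          lam₀ * fderiv ℝ P.Phi (p.point (p.N - 1) P.tf) (σ P.tf, u (p.N - 1) P.tf) := rfl
      simp only [smul_apply, smul_eq_mul, intervalIntegral.integral_const_mul]
      rw [← Finset.mul_sum, e2]
      rw [← e1, costDeriv] at h
      simp only [shift] at h
      linarith)
  rw [hfeas.tau_zero] at h1 h2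
  rw [hfeas.tau_last] at h1 h4
  refine ⟨lam, mu, h1, fun d => ?_, fun l hl t ht => ?_, fun h0 d => ?_⟩
  · rw [h2, ← hpair]
    rfl
  · obtain ⟨i1, i2, i3, i4⟩ := h3 l hl t ht
    exact ⟨i1, i2, fun w => DFunLike.congr_fun i3 w, i4⟩
  · rw [h4 (by ext; simp [βf, h0]), ← hpair]
    simp [βf, h0, βe, B]

theorem fderiv_abnormalHamiltonian (hdomain : IsOpen P.domain)
    (hg : ContDiffOn ℝ 1
      (fun z : (FlatState k × FlatControl m) × ℝ => P.g z.1 z.2) (P.domain ×ˢ Set.univ))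
    {z : FlatState k × FlatControl m} (hz : z ∈ P.domain) (t : ℝ) (lam : FlatState k →L[ℝ] ℝ)
    (mu : Fin c → ℝ) :
    fderiv ℝ (P.abnormalHamiltonian (fun q => lam (Pi.single q 1)) mu t) z =
      lam.comp (integratorCLM k) + ∑ j, mu j • fderiv ℝ (fun z => P.g z t j) z := by
  have h1 : P.abnormalHamiltonian (fun q => lam (Pi.single q 1)) mu t =
      fun z => lam.comp (integratorCLM k) z + ∑ j, mu j * P.g z t j := by
    funext z
    rw [abnormalHamiltonian, sum_single_mul]
    rfl
  rw [h1]
  refine HasFDerivAt.fderiv ((ContinuousLinearMap.hasFDerivAt _).add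
    (HasFDerivAt.fun_sum fun j _ => HasFDerivAt.const_mul ?_ _))
  have h2 : DifferentiableAt ℝ (fun z => P.g z t j) z :=
    DifferentiableAt.comp (g := fun y : (FlatState k × FlatControl m) × ℝ => P.g y.1 y.2 j) z
      ((contDiffAt_constraint hdomain hg hz t j).differentiableAt one_ne_zero)
      (by fun_prop : DifferentiableAt ℝ (fun z : FlatState k × FlatControl m => (z, t)) z)
  exact h2.hasFDerivAt

/-- Fritz John multipliers without cost multiplier are abnormal multipliers. -/
theorem isAbnormalMultiplier (hdomain : IsOpen P.domain)
    (hg : ContDiffOn ℝ 1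
      (fun z : (FlatState k × FlatControl m) × ℝ => P.g z.1 z.2) (P.domain ×ˢ Set.univ))
    (hfeas : P.IsFeasible p) {nu : Fin b → ℝ} {lam : ℝ → FlatState k →L[ℝ] ℝ}
    {mu : ℕ → ℝ → Fin c → ℝ} (hc : ContinuousOn lam (Icc P.t0 P.tf))
    (h0 : ∀ d, lam P.t0 d = -∑ e, nu e * fderiv ℝ P.bdry (p.s P.t0, p.s P.tf) (d, 0) e)
    (hf : ∀ d, lam P.tf d = ∑ e, nu e * fderiv ℝ P.bdry (p.s P.t0, p.s P.tf) (0, d) e)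
    (hmu : ∀ l < p.N, ∀ t ∈ p.openArc l,
      (∀ j, 0 ≤ mu l t j) ∧ (∀ j, j ∉ P.activeSet p l t → mu l t j = 0) ∧
      (∀ w, P.hamiltonianDeriv p 0 lam mu l t (0, w) = 0) ∧
      HasDerivAt lam (-(P.hamiltonianDeriv p 0 lam mu l t).comp
        (ContinuousLinearMap.inl ℝ (FlatState k) (FlatControl m))) t) :
    P.IsAbnormalMultiplier p (fun t q => lam t (Pi.single q 1)) mu nu := by
  have hH : ∀ l < p.N, ∀ t ∈ p.openArc l, fderiv ℝ (P.abnormalHamiltonian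
      (fun q => lam t (Pi.single q 1)) (mu l t) t) (p.point l t) =
      P.hamiltonianDeriv p 0 lam mu l t := fun l hl t ht => by
    rw [fderiv_abnormalHamiltonian hdomain hg
      (hfeas.mem_domain l hl t (Ioo_subset_Icc_self ht)), hamiltonianDeriv, zero_smul, add_zero]
    rfl
  refine ⟨continuousOn_pi.2 fun q => hc.clm_apply continuousOn_const,
    fun l hl t ht i n => ?_, fun l hl t ht i => ?_, fun l hl t ht => (hmu l hl t ht).1,
    fun l hl t ht j => ?_, fun d => ?_, fun d => ?_⟩
  · have h1 := (hmu l hl t ht).2.2.2.clm_apply (hasDerivAt_const t (Pi.single ⟨i, n⟩ (1 : ℝ)))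
    refine h1.congr_deriv ?_
    rw [jetPartial, hH l hl t ht, jetDir, dif_pos n.2]
    simp
  · rw [jetPartial, hH l hl t ht, jetDir_top]
    exact (hmu l hl t ht).2.2.1 _
  · by_cases hj : j ∈ P.activeSet p l t
    · rw [show P.g (p.point l t) t j = 0 from hj, mul_zero]
    · rw [(hmu l hl t ht).2.1 j hj, zero_mul]
  · rw [sum_single_mul, h0]
  · rw [sum_single_mul, hf]

/-- Existence of an adjoint arc and multipliers with cost multiplier `1` on a normal optimal
trajectory. -/
theorem IsOptimal.exists_adjoint_of_isNormal (htime : P.t0 < P.tf) (hdomain : IsOpen P.domain)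
    (hPsi : ContDiffOn ℝ 1 P.Psi P.domain) (hPhi : ContDiffOn ℝ 1 P.Phi P.domain)
    (hg : ContDiffOn ℝ 1
      (fun z : (FlatState k × FlatControl m) × ℝ => P.g z.1 z.2) (P.domain ×ˢ Set.univ))
    (hopt : P.IsOptimal p) (hbdry : ContDiffAt ℝ 1 P.bdry (p.s P.t0, p.s P.tf))
    (hindep : P.ActiveGradientsIndependent p) (hnormal : P.IsNormal p) :
    ∃ (lam : ℝ → FlatState k →L[ℝ] ℝ) (mu : ℕ → ℝ → Fin c → ℝ),
      ∀ l < p.N, ∀ t ∈ p.openArc l,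
        (∀ j, 0 ≤ mu l t j) ∧ (∀ j, j ∉ P.activeSet p l t → mu l t j = 0) ∧
        (∀ w, P.hamiltonianDeriv p 1 lam mu l t (0, w) = 0) ∧
        HasDerivAt lam (-(P.hamiltonianDeriv p 1 lam mu l t).comp
          (ContinuousLinearMap.inl ℝ (FlatState k) (FlatControl m))) t := by
  obtain ⟨nu, lam₀, hlam₀, hne, hFJ⟩ :=
    hopt.exists_fritzJohn htime hdomain hPsi hPhi hg hbdry
  -- For `lam₀ = 0` the vector `nu ≠ 0` would belong to an abnormal multiplier.
  rcases hlam₀.eq_or_lt with rfl | hpos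
  · obtain ⟨lam, mu, h1, h2, h3, h4⟩ :=
      exists_adjoint htime hdomain hPsi hg hopt.1 hindep hFJ
    have hnu := (hnormal _ _ _
      (isAbnormalMultiplier hdomain hg hopt.1 h1 h2 (h4 rfl) h3)).2.2
    exact (hne.elim (fun h => h hnu) fun h => h rfl).elim
  · have hFJ' : ∀ δ ∈ p.variations, P.IsStrict p δ →
        0 ≤ ∑ e, (nu e / lam₀) * fderiv ℝ P.bdry (p.s P.t0, p.s P.tf) (δ.1 P.t0, δ.1 P.tf) e +
          1 * P.costDeriv p δ := fun δ hδ hs => by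
      have h := div_nonneg (hFJ δ hδ hs) hpos.le
      rw [add_div, mul_div_cancel_left₀ _ hpos.ne', Finset.sum_div] at h
      rw [one_mul]
      refine h.trans_eq (congrArg (· + _) (Finset.sum_congr rfl fun e _ => ?_))
      ring
    obtain ⟨lam, mu, -, -, h3, -⟩ := exists_adjoint htime hdomain hPsi hg hopt.1 hindep hFJ'
    exact ⟨lam, mu, h3⟩

/-- The dynamics make the state smoother than the control by one order. -/
theorem contDiffOn_point (hfeas : P.IsFeasible p) {r : ℕ} {l : ℕ} (hl : l < p.N)
    (ha : ContDiffOn ℝ r (p.a l) (p.openArc l)) : ContDiffOn ℝ r (p.point l) (p.openArc l) := by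
  have hs : ContDiffOn ℝ (r + 1) p.s (p.openArc l) := by
    refine contDiffOn_succ_of_hasDerivAt isOpen_Ioo r (fun t ht =>
      (hfeas.dynamics l hl t (Ioo_subset_Icc_self ht)).hasDerivAt (Icc_mem_nhds ht.1 ht.2))
      fun j hj hs => ?_
    exact (integratorCLM k).contDiff.comp_contDiffOn
      (hs.prodMk (ha.of_le (by exact_mod_cast hj)))
  exact (hs.of_le (by exact_mod_cast Nat.le_succ r)).prodMk ha

end FlatProblem
end Flat

namespace FlatProblem
open FlatTrajectory

variable {m : ℕ} {k : Fin m → ℕ} {c b : ℕ} {P : FlatProblem k c b} {p : FlatTrajectory k}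

theorem ActiveSetConstant.mem_activeSet_of_mem (h : P.ActiveSetConstant p) {l : ℕ} (hl : l < p.N)
    {t t' : ℝ} (ht : t ∈ p.openArc l) (ht' : t' ∈ p.openArc l) {j : Fin c}
    (hj : j ∈ P.activeSet p l t) : j ∈ P.activeSet p l t' := by
  rcases h l hl j with h0 | h0
  · exact h0 t' ht'
  · exact absurd hj (h0 t ht).ne

/-- Multipliers determined by stationarity of the Hamiltonian are as smooth as the adjoint arc
and the data. -/
theorem contDiffOn_multiplier {l : ℕ} (hl : l < p.N) (hactive : P.ActiveSetConstant p)
    (hindep : P.ActiveGradientsIndependent p) {n : WithTop ℕ∞} {lam₀ : ℝ}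
    {lam : ℝ → FlatState k →L[ℝ] ℝ} {mu : ℕ → ℝ → Fin c → ℝ}
    (hlam : ContDiffOn ℝ n lam (p.openArc l))
    (hPsi : ContDiffOn ℝ n (fun t => fderiv ℝ P.Psi (p.point l t)) (p.openArc l))
    (hg : ∀ j, ContDiffOn ℝ n (fun t => P.gradConstraint p l t j) (p.openArc l))
    (hinact : ∀ t ∈ p.openArc l, ∀ j, j ∉ P.activeSet p l t → mu l t j = 0)
    (hstat : ∀ t ∈ p.openArc l, ∀ w, P.hamiltonianDeriv p lam₀ lam mu l t (0, w) = 0) :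
    ContDiffOn ℝ n (mu l) (p.openArc l) := by
  refine contDiffOn_pi.2 fun i t₀ ht₀ => ?_
  have ht₀c : t₀ ∈ p.closedArc l := Ioo_subset_Icc_self ht₀
  by_cases hi : i ∈ P.activeSet p l t₀
  · obtain ⟨R, hR, hRγ⟩ := exists_local_right_inverse (P.activeSet p l t₀)
      (γ := fun t j => (P.gradConstraint p l t j).comp
        (ContinuousLinearMap.inr ℝ (FlatState k) (FlatControl m)))
      (fun j => ((hg j).clm_comp contDiffOn_const) t₀ ht₀)
      (hindep.linearIndependent hl ht₀c)
    have hh : ContDiffWithinAt ℝ n (fun t => -((lam t).comp (integratorCLM k) +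
        lam₀ • fderiv ℝ P.Psi (p.point l t)).comp
        (ContinuousLinearMap.inr ℝ (FlatState k) (FlatControl m)) (R t (Pi.single i 1)))
        (p.openArc l) t₀ :=
      (((((hlam t₀ ht₀).clm_comp contDiffWithinAt_const).add
        ((hPsi t₀ ht₀).const_smul lam₀)).clm_comp contDiffWithinAt_const).clm_apply
        (hR.clm_apply contDiffWithinAt_const)).neg
    have hev : ∀ᶠ t in 𝓝[p.openArc l] t₀, mu l t i = -((lam t).comp (integratorCLM k) +
        lam₀ • fderiv ℝ P.Psi (p.point l t)).comp
        (ContinuousLinearMap.inr ℝ (FlatState k) (FlatControl m)) (R t (Pi.single i 1)) := by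
      filter_upwards [hRγ, self_mem_nhdsWithin] with t h1 ht
      -- On this control only the `i`-th of the active gradients is nonzero, so stationarity
      -- isolates `mu l t i`. The active set is constant, so the inactive multipliers drop out at
      -- all nearby times.
      have h2 := hstat t ht (R t (Pi.single i 1))
      have h3 : ∀ j, mu l t j * P.gradConstraint p l t j (0, R t (Pi.single i 1)) =
          if j = i then mu l t j else 0 := fun j => by
        by_cases hj : j ∈ P.activeSet p l t₀
        · have := h1 (Pi.single i 1) j hj
          simp only [ContinuousLinearMap.comp_apply, ContinuousLinearMap.inr_apply] at this
          rw [this, Pi.single_apply]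
          split_ifs <;> simp
        · rw [hinact t ht j fun h => hj (hactive.mem_activeSet_of_mem hl ht ht₀ h)]
          simp
      rw [hamiltonianDeriv, _root_.add_apply, sum_apply] at h2
      simp only [smul_apply, smul_eq_mul, h3, Finset.sum_ite_eq', Finset.mem_univ, if_true] at h2
      rw [ContinuousLinearMap.comp_apply, ContinuousLinearMap.inr_apply]
      linarith
    exact hh.congr_of_eventuallyEq hev (hev.self_of_nhdsWithin ht₀)
  · refine (contDiffWithinAt_const (c := (0 : ℝ))).congr (fun t ht => ?_) ?_
    · exact hinact t ht i fun h => hi (hactive.mem_activeSet_of_mem hl ht ht₀ h)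
    · exact hinact t₀ ht₀ i hi

theorem lagrangianPartial_eq (mu : ℕ → ℝ → Fin c → ℝ) (l : ℕ) (i : Fin m) (n : ℕ) (t : ℝ) :
    P.lagrangianPartial p mu l i n t = fderiv ℝ P.Psi (p.point l t) (jetDir k i n) +
      ∑ j, mu l t j * P.gradConstraint p l t j (jetDir k i n) := rfl

theorem hamiltonianDeriv_jetDir (lam : ℝ → FlatState k →L[ℝ] ℝ) (mu : ℕ → ℝ → Fin c → ℝ)
    (l : ℕ) (i : Fin m) (n : ℕ) (t : ℝ) :
    P.hamiltonianDeriv p 1 lam mu l t (jetDir k i n) =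
      lam t (integratorCLM k (jetDir k i n)) + P.lagrangianPartial p mu l i n t := by
  rw [lagrangianPartial_eq, hamiltonianDeriv]
  simp [add_assoc]

end FlatProblem

end

theorem theorem2 {m : ℕ} (k : Fin m → ℕ) (c b r : ℕ) (hr : ∀ i, k i ≤ r)
    (P : FlatProblem k c b) (htime : P.t0 < P.tf) (hdomain : IsOpen P.domain)
    (hPsi : ContDiffOn ℝ (r + 1) P.Psi P.domain)
    (hPhi : ContDiffOn ℝ 1 P.Phi P.domain)
    (hg : ContDiffOn ℝ (r + 1)
      (fun z : (FlatState k × FlatControl m) × ℝ => P.g z.1 z.2) (P.domain ×ˢ Set.univ))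
    (p : FlatTrajectory k) (hopt : P.IsOptimal p)
    (hbdry : ContDiffAt ℝ 1 P.bdry (p.s P.t0, p.s P.tf))
    (hsmooth : ∀ l < p.N, ContDiffOn ℝ r (p.a l) (p.openArc l))
    (hactive : P.ActiveSetConstant p)
    (hindep : P.ActiveGradientsIndependent p)
    (hnormal : P.IsNormal p) :
    ∃ mu : ℕ → ℝ → Fin c → ℝ, ∀ l < p.N,
      ContDiffOn ℝ r (mu l) (p.openArc l) ∧
      (∀ t ∈ p.openArc l, ∀ j, 0 ≤ mu l t j ∧ mu l t j * P.g (p.point l t) t j = 0) ∧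
      ∀ t ∈ p.openArc l, ∀ i : Fin m,
        (∀ n ≤ k i, ContDiffAt ℝ n (P.lagrangianPartial p mu l i n) t) ∧
        ∑ n ∈ Finset.range (k i + 1),
          (-1 : ℝ) ^ n * iteratedDeriv n (P.lagrangianPartial p mu l i n) t = 0 := by
  have hle : (1 : WithTop ℕ∞) ≤ r + 1 := le_add_self
  have hPsi1 := hPsi.of_le hle
  have hg1 := hg.of_le hle
  have hfeas := hopt.1
  obtain ⟨lam, mu, hmu⟩ := hopt.exists_adjoint_of_isNormal htime hdomain hPsi1 hPhi hg1 hbdry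
    hindep hnormal
  refine ⟨mu, fun l hl => ?_⟩
  have hopen : IsOpen (p.openArc l) := isOpen_Ioo
  have hdom : ∀ t ∈ p.openArc l, p.point l t ∈ P.domain := fun t ht =>
    hfeas.mem_domain l hl t (Ioo_subset_Icc_self ht)
  have hpoint := FlatProblem.contDiffOn_point hfeas hl (hsmooth l hl)
  have hdPsi : ContDiffOn ℝ r (fun t => fderiv ℝ P.Psi (p.point l t)) (p.openArc l) :=
    (hPsi.fderiv_of_isOpen hdomain le_rfl).comp hpoint hdom
  have hdg : ∀ j, ContDiffOn ℝ r (fun t => P.gradConstraint p l t j) (p.openArc l) := fun j =>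
    FlatProblem.contDiffOn_gradConstraint hdomain hg1 hg hdom hpoint j
  -- Half of the bootstrap: stationarity passes the smoothness of `lam` to `mu`; the adjoint
  -- equation then gains one order for `lam`.
  have hmuC : ∀ j : ℕ, j ≤ r → ContDiffOn ℝ j lam (p.openArc l) →
      ContDiffOn ℝ j (mu l) (p.openArc l) := fun j hj hlam => by
    have hj' : (j : WithTop ℕ∞) ≤ r := by exact_mod_cast hj
    exact FlatProblem.contDiffOn_multiplier hl hactive hindep hlam (hdPsi.of_le hj')
      (fun i => (hdg i).of_le hj') (fun t ht => (hmu l hl t ht).2.1)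
      fun t ht => (hmu l hl t ht).2.2.1
  have hlamC : ContDiffOn ℝ (r + 1) lam (p.openArc l) := by
    refine contDiffOn_succ_of_hasDerivAt hopen r (fun t ht => (hmu l hl t ht).2.2.2)
      fun j hj hlam => ?_
    have hj' : (j : WithTop ℕ∞) ≤ r := by exact_mod_cast hj
    refine ContDiffOn.neg (ContDiffOn.clm_comp ?_ contDiffOn_const)
    exact ((hlam.clm_comp contDiffOn_const).add
      ((hdPsi.of_le hj').const_smul (1 : ℝ))).add
      (ContDiffOn.sum fun i _ => (contDiffOn_pi.1 (hmuC j hj hlam) i).smul ((hdg i).of_le hj'))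
  have hmur := hmuC r le_rfl (hlamC.of_le (by exact_mod_cast Nat.le_succ r))
  have hQ : ∀ i n, ContDiffOn ℝ r (P.lagrangianPartial p mu l i n) (p.openArc l) := fun i n =>
    (hdPsi.clm_apply contDiffOn_const).add (ContDiffOn.sum fun j _ =>
      (contDiffOn_pi.1 hmur j).mul ((hdg j).clm_apply contDiffOn_const))
  refine ⟨hmur, fun t ht j => ⟨(hmu l hl t ht).1 j, ?_⟩, fun t ht i => ⟨fun n hn => ?_, ?_⟩⟩
  · by_cases hj : j ∈ P.activeSet p l t
    · rw [show P.g (p.point l t) t j = 0 from hj, mul_zero]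
    · rw [(hmu l hl t ht).2.1 j hj, zero_mul]
  · exact ((hQ i n).contDiffAt (hopen.mem_nhds ht)).of_le (by exact_mod_cast hn.trans (hr i))
  -- The recursion for chain `i`, evaluated at `n = 0`, where the costate is zero.
  · have h0 := costate_eq_alternating_sum hopen (K := k i)
      (lam := fun n t => lam t (integratorCLM k (jetDir k i n)))
      (Q := fun n => P.lagrangianPartial p mu l i n)
      (fun n _ => (hQ i n).of_le (by exact_mod_cast hr i))
      (fun n hn t ht => by
        have h1 := (hmu l hl t ht).2.2.2.clm_apply
          (hasDerivAt_const t (integratorCLM k (jetDir k i (n + 1))))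
        refine h1.congr_deriv ?_
        rw [map_zero, add_zero, _root_.neg_apply, ContinuousLinearMap.comp_apply,
          ContinuousLinearMap.inl_apply, ← jetDir_eq_integrator hn, FlatProblem.hamiltonianDeriv_jetDir])
      (fun t ht => by
        rw [← FlatProblem.hamiltonianDeriv_jetDir, jetDir_top]
        exact (hmu l hl t ht).2.2.1 _)
      (Nat.zero_le _) t ht
    simp only [integratorCLM_jetDir_zero, map_zero, zero_add, Nat.sub_zero] at h0
    rw [← neg_eq_zero, h0, ← Finset.sum_neg_distrib]
    exact Finset.sum_congr rfl fun n _ => by ring
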